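/- Let $-\infty\le a<b\le\infty$ and let $[a,b]$ denote the set of real $x$ with $a\le x\le b$. Let $w\ge 0$ be a weight on $[a,b]$, i.e. $\int_a^b|x|^n w(x)\,dx<\infty$ for all $n\ge 0$ and $\int_a^b w(x)\,dx>0$. Let $N$ be even, and let $f$ be a (real- or complex-valued) Schwartz function on $\mathbb{R}$ with $f(a)=f(b)$, where $f(\pm\infty):=0$ (no condition if $[a,b]=\mathbb{R}$; in particular this holds if $f$ vanishes at the finite endpoints). Put $$G_N^{(1)}(f)=\frac{\int_{[a,b]^N}\prod_{1\le j<k\le N}|x_j-x_k|\prod_{j=1}^N w(x_j)\,[1+f(x_j)]\,dx_1\cdots dx_N}{\int_{[a,b]^N}\prod_{1\le j<k\le N}|x_j-x_k|\prod_{j=1}^N w(x_j)\,dx_1\cdots dx_N}.$$ Let $\varepsilon$ be the integral operator on $[a,b]$ with kernel $\varepsilon(x,y)=\tfrac12\operatorname{sgn}(x-y)$. For $j=0,\dots,N-1$ let $\pi_j$ be an arbitrary polynomial of degree exactly $j$, with coefficients in the field where $f$ takes its values, and let $\psi_j(x)=\pi_j(x)w(x)$. Let $$M=\left(\int_a^b\psi_j(x)\,\varepsilon\psi_k(x)\,dx\right)_{j,k=0}^{N-1}.$$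 Then the two integrals defining $G_N^{(1)}(f)$ converge absolutely, the one in the denominator is positive, and $M$ is invertible. Moreover, with $M^{-1}=(\mu_{jk})_{j,k=0}^{N-1}$ and with $K$ the integral operator on $[a,b]$ with kernel $$K(x,y)=\sum_{j,k=0}^{N-1}\mu_{jk}\,\varepsilon\psi_j(x)\,\psi_k(y),$$ one has $$\left[G_N^{(1)}(f)\right]^2=\det\left(I+K(f^2+2f)-K\varepsilon f'-Kf\varepsilon f'\right).$$ Here functions stand for multiplication operators, products of integral operators have the composed kernels, and $\det(I+T)$ is the Fredholm determinant of the integral operator $T$ on $[a,b]$ with kernel $T(x,y)$, i.e. the sum of the convergent Fredholm series $\sum_{n\ge0}\frac1{n!}\int_{[a,b]^n}\det\left(T(x_i,x_j)\right)_{i,j=1}^n dx_1\cdots dx_n$ with absolutely convergent integrals. -/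

import Mathlib

noncomputable section

namespace OrthogonalEnsemble

open MeasureTheory

variable {𝕜 : Type*} [RCLike 𝕜]

/-- The real interval `[a, b]`, where `a = -∞` and `b = +∞` are allowed. -/
def interval (a b : EReal) : Set ℝ := {x : ℝ | a ≤ (x : EReal) ∧ (x : EReal) ≤ b}

/-- The value at an endpoint of a function that decays at infinity: `f e` for a finite `e`,
and the limit `0` for `e = ±∞`. -/
def endValue (f : ℝ → 𝕜) (e : EReal) : 𝕜 := if e = ⊥ ∨ e = ⊤ then 0 else f e.toReal

/-- `w` is a weight on `I`: nonnegative, not almost everywhere zero, with finite moments. -/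
structure IsWeight (I : Set ℝ) (w : ℝ → ℝ) : Prop where
  nonneg : ∀ x ∈ I, 0 ≤ w x
  moments : ∀ n : ℕ, IntegrableOn (fun x => x ^ n * w x) I
  pos : 0 < ∫ x in I, w x

/-- The cube `I ^ n`. -/
def cube (I : Set ℝ) (n : ℕ) : Set (Fin n → ℝ) := Set.univ.pi fun _ => I

/-- The unnormalised joint density `∏_{j<k} |x_j - x_k| ∏_j w(x_j)` for `β = 1`. -/
def density (w : ℝ → ℝ) (N : ℕ) (x : Fin N → ℝ) : ℝ :=
  (∏ j : Fin N, ∏ k ∈ Finset.Ioi j, |x j - x k|) * ∏ j : Fin N, w (x j)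

/-- The normalisation integral; its inverse is the constant `C_N`. -/
def partitionFunction (I : Set ℝ) (w : ℝ → ℝ) (N : ℕ) : ℝ :=
  ∫ x in cube I N, density w N x

/-- The integrand of the generating function. -/
def genIntegrand (w : ℝ → ℝ) (N : ℕ) (f : ℝ → 𝕜) (x : Fin N → ℝ) : 𝕜 :=
  (density w N x : 𝕜) * ∏ j : Fin N, (1 + f (x j))

/-- The generating function `G_N(f)` of the orthogonal ensemble. -/
def genFun (I : Set ℝ) (w : ℝ → ℝ) (N : ℕ) (f : ℝ → 𝕜) : 𝕜 :=
  ((partitionFunction I w N : ℝ) : 𝕜)⁻¹ * ∫ x in cube I N, genIntegrand w N f x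

/-- The kernel `ε(x, y) = sgn(x - y) / 2`. -/
def epsKernel (x y : ℝ) : 𝕜 := ((Real.sign (x - y) / 2 : ℝ) : 𝕜)

/-- The action of `ε` on functions on `I`. -/
def eps (I : Set ℝ) (g : ℝ → 𝕜) (x : ℝ) : 𝕜 := ∫ t in I, epsKernel x t * g t

/-- `ψ_j = π_j w`. -/
def psi {N : ℕ} (w : ℝ → ℝ) (p : Fin N → Polynomial 𝕜) (j : Fin N) (x : ℝ) : 𝕜 :=
  (p j).eval (x : 𝕜) * (w x : 𝕜)

/-- The matrix `M = (∫ ψ_j εψ_k)`. -/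
def momentMatrix {N : ℕ} (I : Set ℝ) (w : ℝ → ℝ) (p : Fin N → Polynomial 𝕜) :
    Matrix (Fin N) (Fin N) 𝕜 :=
  Matrix.of fun j k => ∫ x in I, psi w p j x * eps I (psi w p k) x

/-- The kernel `∑ μ_{jk} εψ_j(x) ψ_k(y)`, where `(μ_{jk}) = M⁻¹`. -/
def kernel22 {N : ℕ} (I : Set ℝ) (w : ℝ → ℝ) (p : Fin N → Polynomial 𝕜) (x y : ℝ) : 𝕜 :=
  ∑ j : Fin N, ∑ k : Fin N,
    (momentMatrix I w p)⁻¹ j k * eps I (psi w p j) x * psi w p k y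

/-- Kernel of the product `A B` of two integral operators on `I`. -/
def kernelComp (I : Set ℝ) (A B : ℝ → ℝ → 𝕜) (x y : ℝ) : 𝕜 := ∫ z in I, A x z * B z y

/-- Kernel of `A h`, the operator `A` after multiplication by the function `h`. -/
def kernelMul (A : ℝ → ℝ → 𝕜) (h : ℝ → 𝕜) (x y : ℝ) : 𝕜 := A x y * h y

/-- Kernel of the operator `K (f² + 2f) - K ε f' - K f ε f'`. -/
def scalarKernel (I : Set ℝ) (K : ℝ → ℝ → 𝕜) (f : ℝ → 𝕜) (x y : ℝ) : 𝕜 :=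
  kernelMul K (fun t => f t ^ 2 + 2 * f t) x y
    - kernelMul (kernelComp I K epsKernel) (deriv f) x y
    - kernelMul (kernelComp I (kernelMul K f) epsKernel) (deriv f) x y

/-- `d` is the Fredholm determinant `det (I + T)` of the integral operator on `I` with kernel
`T`, that is, the sum of the Fredholm series
`∑ₙ (1 / n!) ∫_{Iⁿ} det (T(x_i, x_j)) dx₁ ⋯ dxₙ`, all of whose terms are integrable. -/
def IsFredholmDet (I : Set ℝ) (T : ℝ → ℝ → 𝕜) (d : 𝕜) : Prop :=
  (∀ n : ℕ, IntegrableOn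
    (fun x : Fin n → ℝ => (Matrix.of fun i j => T (x i) (x j)).det) (cube I n)) ∧
  HasSum (fun n : ℕ => (n.factorial : 𝕜)⁻¹ *
    ∫ x in cube I n, (Matrix.of fun i j => T (x i) (x j)).det) d

end OrthogonalEnsemble

end

namespace OrthogonalEnsemble

/-! ### Algebra of the unnormalised Pfaffian. -/

section PfaffianSum

open Matrix Equiv Finset

/-! Write `N = 2n`. Up to a nonzero constant, `|Δ(x)|` equals the Vandermonde determinant `Δ(x)`
times the Pfaffian of `(ε(x_k, x_l))`, since sorting the points multiplies both factors by the same
sign (`det_vandermonde_mul_pfSum`). De Bruijn's argument (`integral_det_mul_pfSum`) then turns `∫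
|Δ| ∏ u(x_j)` into a constant times the Pfaffian of `(∫ φ_j εφ_k)` with `φ_j = π_j u`. The square of
a Pfaffian is a constant times the determinant (`pfSum_sq`), so the squared integral is `κ det (∫
φ_j εφ_k)` with `κ` independent of `u`.

For `u = w` the integral is positive, which forces both `κ ≠ 0` and `det M ≠ 0`. Dividing the case
`u = w (1 + f)` by this one gives `G² = det M_f / det M`, and no constant has to be computed.

The condition `f(a) = f(b)` yields the operator identity `ε f' ε = f ε - ε f`
(`integral_eps_deriv_eps`). It rewrites `M_f` as `M + C`, where `C` pairs the `εψ_k` with the rows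
`ψ_j (f² + 2f - ε f' - f ε f')` (`integral_perturbed`). Finally `det (1 + M⁻¹ C)` is the Fredholm
determinant of the finite-rank kernel in question (`isFredholmDet_finiteRank`), whose Fredholm
series has only finitely many nonzero terms. -/

theorem J_apply_of_ne_swap {α R : Type*} [DecidableEq α] [CommRing R] {k l : α ⊕ α}
    (h : l ≠ k.swap) : J α R k l = 0 := by
  rcases k with a | a <;> rcases l with b | b <;> simp_all [J, eq_comm]

variable {α R : Type*} [Fintype α] [DecidableEq α] [CommRing R]

/-- The unnormalised Pfaffian `∑ σ, sgn σ ∏ a, A (σ a₁) (σ a₂)` of a matrix indexed by two copies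
of `α`, where `a₁` and `a₂` are the two copies of `a`. -/
def pfSum (A : Matrix (α ⊕ α) (α ⊕ α) R) : R :=
  ∑ σ : Perm (α ⊕ α), ((Perm.sign σ : ℤ) : R) * ∏ a, A (σ (.inl a)) (σ (.inr a))

theorem sum_sign_mul_prod_apply (B : Matrix (α ⊕ α) (α ⊕ α) R) (p : α ⊕ α → α ⊕ α) :
    ∑ σ : Perm (α ⊕ α), ((Perm.sign σ : ℤ) : R) * ∏ k, B (σ k) (p k) =
      (B.submatrix id p).det := by
  rw [det_apply']
  rfl

theorem prod_conj_apply (A B : Matrix (α ⊕ α) (α ⊕ α) R) (σ : α ⊕ α → α ⊕ α) :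
    ∏ a, (B * A * Bᵀ) (σ (.inl a)) (σ (.inr a)) =
      ∑ p : α ⊕ α → α ⊕ α, (∏ k, B (σ k) (p k)) * ∏ a, A (p (.inl a)) (p (.inr a)) := by
  have h (a : α) : (B * A * Bᵀ) (σ (.inl a)) (σ (.inr a)) =
      ∑ q : (α ⊕ α) × (α ⊕ α),
        B (σ (.inl a)) q.1 * B (σ (.inr a)) q.2 * A q.1 q.2 := by
    rw [Fintype.sum_prod_type_right]
    simp only [mul_apply, transpose_apply, sum_mul]
    exact sum_congr rfl fun l _ => sum_congr rfl fun k _ => by ring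
  simp_rw [h]
  rw [prod_univ_sum, Fintype.piFinset_univ]
  let E : (α → (α ⊕ α) × (α ⊕ α)) ≃ (α ⊕ α → α ⊕ α) :=
    (Equiv.arrowProdEquivProdArrow α _ _).trans (Equiv.sumArrowEquivProdArrow α α _).symm
  refine Fintype.sum_equiv E _ _ fun q => ?_
  rw [Fintype.prod_sum_type, ← prod_mul_distrib, ← prod_mul_distrib]
  exact prod_congr rfl fun a _ => rfl

theorem sum_fun_eq_sum_perm {ι : Type*} [Fintype ι] [DecidableEq ι] {F : (ι → ι) → R}
    (hF : ∀ p, ¬ Function.Injective p → F p = 0) :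
    ∑ p : ι → ι, F p = ∑ σ : Perm ι, F σ := by
  rw [← sum_filter_add_sum_filter_not univ Function.Bijective,
    sum_eq_zero (s := filter (fun p => ¬ Function.Bijective p) univ), add_zero]
  · exact sum_bij (fun p h => Equiv.ofBijective p (mem_filter.1 h).2) (fun _ _ => mem_univ _)
      (fun _ _ _ _ h => by injection h)
      (fun b _ => ⟨b, mem_filter.2 ⟨mem_univ _, b.bijective⟩, coe_fn_injective rfl⟩) fun _ _ => rfl
  · intro p hp
    exact hF p fun h => (mem_filter.1 hp).2 (Finite.injective_iff_bijective.1 h)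

/-- The argument is that for multiplicativity of `det`. Expanding the entries gives a sum over maps
`p` of column choices, weighted by the determinant of the chosen columns of `B`. A non-injective `p`
repeats a column, and a permutation contributes its sign times `det B`. -/
theorem pfSum_conj (A B : Matrix (α ⊕ α) (α ⊕ α) R) :
    pfSum (B * A * Bᵀ) = B.det * pfSum A := by
  have h1 : pfSum (B * A * Bᵀ) =
      ∑ p : α ⊕ α → α ⊕ α, (B.submatrix id p).det * ∏ a, A (p (.inl a)) (p (.inr a)) := by
    simp_rw [pfSum, prod_conj_apply, mul_sum, ← sum_sign_mul_prod_apply, sum_mul]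
    rw [sum_comm]
    exact sum_congr rfl fun _ _ => sum_congr rfl fun _ _ => by ring
  rw [h1, sum_fun_eq_sum_perm, pfSum, mul_sum]
  · refine sum_congr rfl fun σ _ => ?_
    rw [det_permute' σ B]
    ring
  · intro p hp
    obtain ⟨i, j, hij, hne⟩ : ∃ i j, p i = p j ∧ i ≠ j := by
      unfold Function.Injective at hp
      push Not at hp
      exact hp
    rw [det_zero_of_column_eq hne fun k => by simp [hij], zero_mul]

theorem pfSum_submatrix_perm (A : Matrix (α ⊕ α) (α ⊕ α) R) (τ : Perm (α ⊕ α)) :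
    pfSum (A.submatrix τ τ) = ((Perm.sign τ : ℤ) : R) * pfSum A := by
  rw [pfSum, pfSum, mul_sum]
  refine Fintype.sum_equiv (Equiv.mulLeft τ) _ _ fun σ => ?_
  have h : ((Perm.sign τ : ℤ) : R) * ((Perm.sign τ : ℤ) : R) = 1 := by
    rw [← Int.cast_mul, ← Units.val_mul, Int.units_mul_self]; simp
  simp only [Equiv.coe_mulLeft, Perm.sign_mul, Units.val_mul, Int.cast_mul, submatrix_apply,
    Perm.mul_apply]
  rw [← mul_assoc, ← mul_assoc, h, one_mul]

theorem pfSum_eq_zero_of_row_eq_zero {A : Matrix (α ⊕ α) (α ⊕ α) R} {i : α ⊕ α}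
    (hr : ∀ j, A i j = 0) (hc : ∀ j, A j i = 0) : pfSum A = 0 := by
  refine sum_eq_zero fun σ _ => mul_eq_zero_of_right _ ?_
  rcases h : σ.symm i with a | a
  · exact prod_eq_zero (mem_univ a) (by rw [← h, apply_symm_apply, hr])
  · exact prod_eq_zero (mem_univ a) (by rw [← h, apply_symm_apply, hc])

/-- A permutation that respects the pairing becomes symplectic once its matrix is corrected by the
signs `d`. Symplectic matrices have determinant one, which ties `sign σ` to the product of those
signs. -/
theorem sign_mul_prod_J (σ : Perm (α ⊕ α))
    (hσ : ∀ a, σ (.inr a) = (σ (.inl a)).swap) :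
    ((Perm.sign σ : ℤ) : R) * ∏ a, J α R (σ (.inl a)) (σ (.inr a)) = (-1) ^ Fintype.card α := by
  let d : α ⊕ α → R := Sum.elim 1 fun a => - J α R (σ (.inl a)) (σ (.inr a))
  have hswap (k : α ⊕ α) : σ k.swap = (σ k).swap := by
    rcases k with a | a
    · simp [hσ]
    · simp [hσ]
  have hanti (k l : α ⊕ α) : J α R k l = - J α R l k := by
    have := congrFun (congrFun (J_transpose α R) l) k
    simpa using this
  let P : Matrix (α ⊕ α) (α ⊕ α) R := (1 : Matrix (α ⊕ α) (α ⊕ α) R).submatrix σ.symm id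
  have hB : P * diagonal d ∈ symplecticGroup α R := by
    rw [SymplecticGroup.mem_iff]
    ext i j
    obtain ⟨k, rfl⟩ := σ.surjective i
    obtain ⟨l, rfl⟩ := σ.surjective j
    have : (P * diagonal d * J α R * (P * diagonal d)ᵀ) (σ k) (σ l) = d k * J α R k l * d l := by
      have hP (m j) : (P * diagonal d) (σ m) j = if m = j then d m else 0 := by
        simp only [mul_diagonal, P, submatrix_apply, symm_apply_apply, id, Matrix.one_apply]
        split_ifs with h <;> simp [h]
      rw [mul_apply]
      simp_rw [transpose_apply, mul_apply (N := J α R), hP]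
      simp only [ite_mul, zero_mul, mul_ite, mul_zero, sum_ite_eq, mem_univ, if_true]
    rw [this]
    by_cases h : l = k.swap
    · subst h
      rcases k with a | a
      · have : J α R (.inl a) (.inr a) = -1 := by simp [J]
        simp [d, this]
      · have : J α R (.inr a) (.inl a) = 1 := by simp [J]
        simp [d, this, hanti (σ (.inl a))]
    · rw [J_apply_of_ne_swap h, J_apply_of_ne_swap fun h' => h (σ.injective (by rw [h', hswap]))]
      simp
  have hdet := SymplecticGroup.det_eq_one hB
  have hP : P.det = ((Perm.sign σ : ℤ) : R) := by
    rw [show P = (1 : Matrix (α ⊕ α) (α ⊕ α) R).submatrix σ.symm id from rfl,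
      det_permute, det_one, Perm.sign_symm, mul_one]
  rw [det_mul, det_diagonal, hP, Fintype.prod_sum_type] at hdet
  simp only [d, Sum.elim_inl, Sum.elim_inr, Pi.one_apply, prod_const_one, one_mul,
    prod_neg, card_univ] at hdet
  have h1 : ((-1 : R) ^ Fintype.card α) * (-1) ^ Fintype.card α = 1 := by
    rw [← mul_pow]; simp
  linear_combination ((-1 : R) ^ Fintype.card α) * hdet -
    (((Perm.sign σ : ℤ) : R) * ∏ a, J α R (σ (.inl a)) (σ (.inr a))) * h1

/-- Only permutations respecting the pairing contribute, and all contribute the same sign, so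
nothing cancels. -/
theorem pfSum_J_ne_zero [IsDomain R] [CharZero R] : pfSum (J α R) ≠ 0 := by
  classical
  have h : pfSum (J α R) = (#{σ : Perm (α ⊕ α) | ∀ a, σ (.inr a) = (σ (.inl a)).swap} : R) *
      (-1) ^ Fintype.card α := by
    rw [pfSum, ← sum_filter_add_sum_filter_not univ
      (fun σ : Perm (α ⊕ α) => ∀ a, σ (.inr a) = (σ (.inl a)).swap)]
    rw [sum_congr rfl fun σ hσ => sign_mul_prod_J σ (mem_filter.1 hσ).2, sum_const, nsmul_eq_mul,
      sum_eq_zero, add_zero]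
    intro σ hσ
    obtain ⟨a, ha⟩ := not_forall.1 (mem_filter.1 hσ).2
    rw [prod_eq_zero (mem_univ a) (J_apply_of_ne_swap ha), mul_zero]
  rw [h]
  refine mul_ne_zero (Nat.cast_ne_zero.2 (card_ne_zero.2 ⟨1, ?_⟩)) (by simp)
  simp

end PfaffianSum

/-! ### Skew matrices up to congruence, and the square of the Pfaffian. -/

section Congruence

open Matrix Finset

variable {K : Type*} [Field K]

theorem dotProduct_mulVec_comm_of_skew {ι : Type*} [Fintype ι] {A : Matrix ι ι K}
    (hA : Aᵀ = -A) (x y : ι → K) : x ⬝ᵥ A *ᵥ y = -(y ⬝ᵥ A *ᵥ x) := by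
  rw [dotProduct_mulVec, ← mulVec_transpose, hA, neg_mulVec, neg_dotProduct, dotProduct_comm]

/-- Symplectic Gram–Schmidt: one hyperbolic pair is added at each step of the induction. -/
theorem exists_gram_eq_J {ι : Type*} [Fintype ι] [DecidableEq ι] [NeZero (2 : K)]
    {A : Matrix ι ι K} (hA : Aᵀ = -A) (hdet : A.det ≠ 0) (m : ℕ) (hm : m + m ≤ Fintype.card ι) :
    ∃ b : Fin m ⊕ Fin m → ι → K, ∀ k l, b k ⬝ᵥ A *ᵥ b l = J (Fin m) K k l := by
  induction m with
  | zero => exact ⟨fun _ => 0, fun k => by rcases k with k | k <;> exact k.elim0⟩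
  | succ m ih =>
    obtain ⟨b, hb⟩ := ih (by lia)
    have hself (x : ι → K) : x ⬝ᵥ A *ᵥ x = 0 := by
      have h := dotProduct_mulVec_comm_of_skew hA x x
      have h2 : (2 : K) * (x ⬝ᵥ A *ᵥ x) = 0 := by linear_combination h
      exact (mul_eq_zero.1 h2).resolve_left two_ne_zero
    -- The `2m` linear conditions are fewer than the dimension, so they have a nonzero solution.
    obtain ⟨v, hv, hv0⟩ : ∃ v : ι → K, (∀ k, b k ⬝ᵥ A *ᵥ v = 0) ∧ v ≠ 0 := by
      let T : (ι → K) →ₗ[K] (Fin m ⊕ Fin m → K) := (Matrix.of b * A).mulVecLin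
      have hT : T.ker ≠ ⊥ := LinearMap.ker_ne_bot_of_finrank_lt (by simp; lia)
      obtain ⟨v, hvT, hv0⟩ := Submodule.exists_mem_ne_zero_of_ne_bot hT
      refine ⟨v, fun k => ?_, hv0⟩
      have := congrFun (LinearMap.mem_ker.1 hvT) k
      simpa [T, ← mulVec_mulVec, mulVec] using this
    obtain ⟨u₀, hu₀⟩ : ∃ u₀ : ι → K, v ⬝ᵥ A *ᵥ u₀ ≠ 0 := by
      by_contra! h
      refine hv0 (eq_zero_of_vecMul_eq_zero hdet ?_)
      ext i
      have := h (Pi.single i 1)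
      rwa [dotProduct_mulVec, dotProduct_single_one] at this
    -- Projecting `u₀` off the earlier pairs leaves its pairing with `v` unchanged.
    let u : ι → K := u₀ + ∑ a, ((b (.inl a) ⬝ᵥ A *ᵥ u₀) • b (.inr a) -
      (b (.inr a) ⬝ᵥ A *ᵥ u₀) • b (.inl a))
    have hωu (x : ι → K) : x ⬝ᵥ A *ᵥ u = x ⬝ᵥ A *ᵥ u₀ +
        ∑ a, ((b (.inl a) ⬝ᵥ A *ᵥ u₀) * (x ⬝ᵥ A *ᵥ b (.inr a)) -
          (b (.inr a) ⬝ᵥ A *ᵥ u₀) * (x ⬝ᵥ A *ᵥ b (.inl a))) := by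
      simp only [u, mulVec_add, dotProduct_add, mulVec_sum, dotProduct_sum, mulVec_sub,
        dotProduct_sub, mulVec_smul, dotProduct_smul, smul_eq_mul]
    have hu (k) : b k ⬝ᵥ A *ᵥ u = 0 := by
      rw [hωu]
      simp only [hb]
      rcases k with k | k <;> simp [J, Matrix.one_apply]
    have hvu : v ⬝ᵥ A *ᵥ u = v ⬝ᵥ A *ᵥ u₀ := by
      rw [hωu, sum_eq_zero, add_zero]
      intro a _
      rw [dotProduct_mulVec_comm_of_skew hA v, dotProduct_mulVec_comm_of_skew hA v, hv, hv]
      simp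
    set t := v ⬝ᵥ A *ᵥ u₀ with ht
    -- The sign matches the entry `-1` of `J` at `(inl a, inr a)`.
    let v' : ι → K := (-t⁻¹) • v
    have hv'u : v' ⬝ᵥ A *ᵥ u = -1 := by
      simp [v', hvu, inv_mul_cancel₀ hu₀]
    have huv' : u ⬝ᵥ A *ᵥ v' = 1 := by
      rw [dotProduct_mulVec_comm_of_skew hA, hv'u, neg_neg]
    have hbv' (k) : b k ⬝ᵥ A *ᵥ v' = 0 := by
      rw [mulVec_smul, dotProduct_smul, hv, smul_zero]
    have hv'b (k) : v' ⬝ᵥ A *ᵥ b k = 0 := by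
      rw [dotProduct_mulVec_comm_of_skew hA, hbv', neg_zero]
    have hub (k) : u ⬝ᵥ A *ᵥ b k = 0 := by
      rw [dotProduct_mulVec_comm_of_skew hA, hu, neg_zero]
    refine ⟨Sum.elim (Fin.cons v' fun a => b (.inl a)) (Fin.cons u fun a => b (.inr a)), ?_⟩
    rintro (k | k) (l | l) <;> refine Fin.cases ?_ (fun k => ?_) k <;>
      refine Fin.cases ?_ (fun l => ?_) l <;>
      simp [hself, hv'u, huv', hbv', hv'b, hu, hub, hb] <;> simp [J, Matrix.one_apply, (Fin.succ_ne_zero _).symm]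

theorem pfSum_eq_zero_of_det_eq_zero {α : Type*} [Fintype α] [DecidableEq α]
    {A : Matrix (α ⊕ α) (α ⊕ α) K} (hA : Aᵀ = -A) (hdet : A.det = 0) : pfSum A = 0 := by
  obtain ⟨v, hv0, hv⟩ := exists_vecMul_eq_zero_iff.2 hdet
  obtain ⟨i, hi⟩ := Function.ne_iff.1 hv0
  -- A null vector `v` with `v i ≠ 0` as row `i` keeps `B` invertible, while row and column `i` of
  -- `B * A * Bᵀ` vanish.
  let B : Matrix (α ⊕ α) (α ⊕ α) K := (1 : Matrix (α ⊕ α) (α ⊕ α) K).updateRow i v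
  have hB : B.det ≠ 0 := by
    have : B.det = v i := by
      have := cramer_transpose_apply (1 : Matrix (α ⊕ α) (α ⊕ α) K) v i
      rw [transpose_one, cramer_one] at this
      simpa [B] using this.symm
    rw [this]
    exact hi
  have hBi : B i = v := by simp [B]
  have hskew : (B * A * Bᵀ)ᵀ = -(B * A * Bᵀ) := by
    simp [transpose_mul, hA, Matrix.mul_assoc]
  have hrow (j) : (B * A * Bᵀ) i j = 0 := by
    have : (B * A) i = 0 := by
      rw [mul_apply_eq_vecMul, hBi, hv]
    simp [mul_apply (M := B * A), this]
  have hcol (j) : (B * A * Bᵀ) j i = 0 := by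
    have := congrFun (congrFun hskew i) j
    rw [transpose_apply] at this
    rw [this, Matrix.neg_apply, hrow, neg_zero]
  have := pfSum_eq_zero_of_row_eq_zero hrow hcol
  rw [pfSum_conj] at this
  exact (mul_eq_zero.1 this).resolve_left hB

/-- An invertible skew `A` is congruent to `J`; comparing how `pfSum` and `det` change under the
congruence gives the identity, since `(det J)² = 1`. The singular case is `0 = 0`. -/
theorem pfSum_sq [NeZero (2 : K)] {n : ℕ} {A : Matrix (Fin n ⊕ Fin n) (Fin n ⊕ Fin n) K} (hA : Aᵀ = -A) :
    pfSum A ^ 2 = pfSum (J (Fin n) K) ^ 2 * (J (Fin n) K).det * A.det := by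
  by_cases hdet : A.det = 0
  · simp [hdet, pfSum_eq_zero_of_det_eq_zero hA hdet]
  obtain ⟨b, hb⟩ := exists_gram_eq_J hA hdet n (by simp)
  have hB : Matrix.of b * A * (Matrix.of b)ᵀ = J (Fin n) K := by
    ext k l
    rw [← hb, dotProduct_mulVec]
    rfl
  have h1 := pfSum_conj A (Matrix.of b)
  have h2 := congrArg det hB
  rw [hB] at h1
  rw [det_mul, det_mul, det_transpose] at h2
  have h3 := J_det_mul_J_det (Fin n) K
  rw [h1]
  generalize (Matrix.of b).det = d at *
  generalize pfSum A = x at *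
  rw [← h2] at h3 ⊢
  linear_combination (-x ^ 2) * h3

end Congruence

/-! ### De Bruijn's integration formula. -/

section DeBruijn

open MeasureTheory Matrix Equiv Finset

variable {𝕜 : Type*} [RCLike 𝕜] {μ : Measure ℝ} [SigmaFinite μ]

theorem measurePreserving_comp_equiv {ι ι' : Type*} [Fintype ι] [Fintype ι'] (e : ι ≃ ι')
    (μ : Measure ℝ) [SigmaFinite μ] :
    MeasurePreserving (MeasurableEquiv.piCongrLeft (fun _ : ι' => ℝ) e).symm
      (Measure.pi fun _ : ι' => μ) (Measure.pi fun _ : ι => μ) :=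
  (measurePreserving_piCongrLeft (fun _ : ι' => μ) e).symm

theorem integral_comp_equiv {ι ι' : Type*} [Fintype ι] [Fintype ι'] (e : ι ≃ ι')
    (F : (ι → ℝ) → 𝕜) :
    ∫ x : ι' → ℝ, F (fun i => x (e i)) ∂Measure.pi (fun _ => μ) =
      ∫ y, F y ∂Measure.pi (fun _ => μ) :=
  (measurePreserving_comp_equiv e μ).integral_comp' F

theorem integrable_comp_equiv {ι ι' : Type*} [Fintype ι] [Fintype ι'] (e : ι ≃ ι')
    {F : (ι → ℝ) → 𝕜} (hF : Integrable F (Measure.pi fun _ => μ)) :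
    Integrable (fun x : ι' → ℝ => F fun i => x (e i)) (Measure.pi fun _ => μ) :=
  ((measurePreserving_comp_equiv e μ).integrable_comp_emb
    (MeasurableEquiv.measurableEmbedding _)).2 hF

variable {α : Type*} [Fintype α] {E : ℝ → ℝ → 𝕜}

theorem integrable_prod_mul_prod_kernel (hE : Measurable (Function.uncurry E))
    (hb : ∀ s t, ‖E s t‖ ≤ 1) {φ : α ⊕ α → ℝ → 𝕜} (hφ : ∀ j, Integrable (φ j) μ) :
    Integrable (fun x : α ⊕ α → ℝ => (∏ k, φ k (x k)) * ∏ a, E (x (.inl a)) (x (.inr a)))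
      (Measure.pi fun _ => μ) := by
  refine (Integrable.fintype_prod hφ).mul_bdd (c := 1) ?_ (ae_of_all _ fun x => ?_)
  · refine Measurable.aestronglyMeasurable (Finset.measurable_prod _ fun a _ => ?_)
    exact hE.comp (f := fun x : α ⊕ α → ℝ => (x (.inl a), x (.inr a))) (by fun_prop)
  · rw [norm_prod]
    exact prod_le_one (fun _ _ => norm_nonneg _) fun _ _ => hb _ _

/-- Each factor of the kernel couples only the two variables of one pair, so Fubini splits the
integral into double integrals. -/
theorem integral_prod_mul_prod_kernel (hE : Measurable (Function.uncurry E))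
    (hb : ∀ s t, ‖E s t‖ ≤ 1) {φ : α ⊕ α → ℝ → 𝕜} (hφ : ∀ j, Integrable (φ j) μ) :
    ∫ x : α ⊕ α → ℝ, (∏ k, φ k (x k)) * ∏ a, E (x (.inl a)) (x (.inr a))
      ∂Measure.pi (fun _ => μ) =
    ∏ a, ∫ s, φ (.inl a) s * ∫ t, E s t * φ (.inr a) t ∂μ ∂μ := by
  have hmp := measurePreserving_sumPiEquivProdPi_symm (X := fun _ : α ⊕ α => ℝ) fun _ => μ
  have hint := (hmp.integrable_comp_emb (MeasurableEquiv.measurableEmbedding _)).2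
    (integrable_prod_mul_prod_kernel hE hb hφ)
  rw [← hmp.integral_comp']
  simp only [Function.comp_def] at hint
  rw [integral_prod _ hint, ← integral_fintype_prod_eq_prod]
  refine integral_congr_ae (ae_of_all _ fun y => ?_)
  simp only
  rw [prod_mul_distrib, ← integral_fintype_prod_eq_prod (fun a t => E (y a) t * φ (.inr a) t),
    ← integral_const_mul]
  refine integral_congr_ae (ae_of_all _ fun z => ?_)
  simp only [Fintype.prod_sum_type, prod_mul_distrib]
  change (∏ a, φ (.inl a) (y a)) * (∏ a, φ (.inr a) (z a)) * ∏ a, E (y a) (z a) = _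
  ring

variable [DecidableEq α]

theorem det_mul_prod_kernel_eq (φ : α ⊕ α → ℝ → 𝕜) (x : α ⊕ α → ℝ) :
    (Matrix.of fun i j => φ j (x i)).det * ∏ a, E (x (.inl a)) (x (.inr a)) =
      ∑ σ : Perm (α ⊕ α), ((Perm.sign σ : ℤ) : 𝕜) *
        ((∏ k, φ (σ k) (x k)) * ∏ a, E (x (.inl a)) (x (.inr a))) := by
  rw [← det_transpose, det_apply', sum_mul]
  exact sum_congr rfl fun σ _ => by simp [mul_assoc]

theorem integrable_det_mul_prod_kernel (hE : Measurable (Function.uncurry E))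
    (hb : ∀ s t, ‖E s t‖ ≤ 1) {φ : α ⊕ α → ℝ → 𝕜} (hφ : ∀ j, Integrable (φ j) μ) :
    Integrable (fun x : α ⊕ α → ℝ => (Matrix.of fun i j => φ j (x i)).det *
      ∏ a, E (x (.inl a)) (x (.inr a))) (Measure.pi fun _ => μ) := by
  simp_rw [det_mul_prod_kernel_eq]
  exact integrable_finsetSum _ fun σ _ =>
    (integrable_prod_mul_prod_kernel hE hb fun j => hφ (σ j)).const_mul _

theorem integral_det_mul_prod_kernel (hE : Measurable (Function.uncurry E))
    (hb : ∀ s t, ‖E s t‖ ≤ 1) {φ : α ⊕ α → ℝ → 𝕜} (hφ : ∀ j, Integrable (φ j) μ) :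
    ∫ x : α ⊕ α → ℝ, (Matrix.of fun i j => φ j (x i)).det *
      ∏ a, E (x (.inl a)) (x (.inr a)) ∂Measure.pi (fun _ => μ) =
    pfSum (Matrix.of fun j k => ∫ s, φ j s * ∫ t, E s t * φ k t ∂μ ∂μ) := by
  simp_rw [det_mul_prod_kernel_eq]
  rw [integral_finsetSum _ fun σ _ =>
    (integrable_prod_mul_prod_kernel hE hb fun j => hφ (σ j)).const_mul _]
  refine sum_congr rfl fun σ _ => ?_
  rw [integral_const_mul, integral_prod_mul_prod_kernel hE hb fun j => hφ (σ j)]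
  rfl

/-- The sign of each term of the inner `pfSum` is absorbed by permuting the rows of the determinant.
Relabelling the variables then shows that all terms have the same integral, whence the factorial. -/
theorem integral_det_mul_pfSum (hE : Measurable (Function.uncurry E))
    (hb : ∀ s t, ‖E s t‖ ≤ 1) {φ : α ⊕ α → ℝ → 𝕜} (hφ : ∀ j, Integrable (φ j) μ) :
    ∫ x : α ⊕ α → ℝ, (Matrix.of fun i j => φ j (x i)).det *
      pfSum (Matrix.of fun k l => E (x k) (x l)) ∂Measure.pi (fun _ => μ) =
    (Fintype.card (α ⊕ α)).factorial *
      pfSum (Matrix.of fun j k => ∫ s, φ j s * ∫ t, E s t * φ k t ∂μ ∂μ) := by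
  have hx (x : α ⊕ α → ℝ) : (Matrix.of fun i j => φ j (x i)).det *
      pfSum (Matrix.of fun k l => E (x k) (x l)) = ∑ τ : Perm (α ⊕ α),
        (Matrix.of fun i j => φ j (x (τ i))).det *
          ∏ a, E (x (τ (.inl a))) (x (τ (.inr a))) := by
    rw [pfSum, mul_sum]
    refine sum_congr rfl fun τ _ => ?_
    have := det_permute τ (Matrix.of fun i j => φ j (x i))
    rw [show (Matrix.of fun i j => φ j (x i)).submatrix τ id =
      Matrix.of fun i j => φ j (x (τ i)) from rfl] at this
    rw [this]
    simp only [of_apply]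
    ring
  simp_rw [hx]
  rw [integral_finsetSum _ fun τ _ =>
    integrable_comp_equiv τ (integrable_det_mul_prod_kernel hE hb hφ)]
  rw [sum_congr rfl fun τ _ => (integral_comp_equiv τ fun x =>
    (Matrix.of fun i j => φ j (x i)).det * ∏ a, E (x (.inl a)) (x (.inr a))).trans
    (integral_det_mul_prod_kernel hE hb hφ)]
  rw [sum_const, card_univ, Fintype.card_perm, nsmul_eq_mul]

end DeBruijn

/-! ### The absolute Vandermonde determinant as a determinant times a Pfaffian. -/

section Vandermonde

open Matrix Equiv Finset

variable {𝕜 : Type*} [RCLike 𝕜]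

theorem epsKernel_comm (x y : ℝ) : (epsKernel x y : 𝕜) = -epsKernel y x := by
  rw [epsKernel, epsKernel, ← neg_sub y x, Real.sign_neg, neg_div, RCLike.ofReal_neg]

theorem det_vandermonde_comp_perm {N : ℕ} (x : Fin N → ℝ) (τ : Perm (Fin N)) :
    (vandermonde fun i => x (τ i)).det = (Perm.sign τ : ℤ) * (vandermonde x).det := by
  rw [← det_permute]
  rfl

theorem det_vandermonde_pos {N : ℕ} {x : Fin N → ℝ} (hx : StrictMono x) :
    0 < (vandermonde x).det := by
  rw [det_vandermonde]
  exact prod_pos fun i _ => prod_pos fun j hj => sub_pos.2 (hx (mem_Ioi.1 hj))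

theorem prod_abs_sub_eq_abs_det_vandermonde {N : ℕ} (x : Fin N → ℝ) :
    ∏ j : Fin N, ∏ k ∈ Ioi j, |x j - x k| = |(vandermonde x).det| := by
  rw [det_vandermonde, abs_prod]
  simp_rw [abs_prod, abs_sub_comm]

/-- The matrix of the kernel `ε` at the points `0, …, N - 1`. -/
noncomputable def orderMatrix (𝕜 : Type*) [RCLike 𝕜] (N : ℕ) : Matrix (Fin N) (Fin N) 𝕜 :=
  Matrix.of fun i j => epsKernel ((i : ℕ) : ℝ) ((j : ℕ) : ℝ)

theorem orderMatrix_transpose (N : ℕ) : (orderMatrix 𝕜 N)ᵀ = -orderMatrix 𝕜 N := by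
  ext i j
  exact epsKernel_comm _ _

theorem epsKernel_comp_strictMono {N : ℕ} {x : Fin N → ℝ} (hx : StrictMono x) (i j : Fin N) :
    (epsKernel (x i) (x j) : 𝕜) = orderMatrix 𝕜 N i j := by
  simp only [orderMatrix, of_apply, epsKernel]
  congr 2
  rcases lt_trichotomy i j with h | h | h
  · rw [Real.sign_of_neg (sub_neg.2 (hx h)), Real.sign_of_neg]
    exact sub_neg.2 (by exact_mod_cast h)
  · simp [h]
  · rw [Real.sign_of_pos (sub_pos.2 (hx h)), Real.sign_of_pos]
    exact sub_pos.2 (by exact_mod_cast h)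

/-- Twice the matrix is an integer matrix that reduces mod 2 to `O - 1`, with `O` the all-ones
matrix. For even `N`, `O² = N O = 0`, so `(O - 1)² = 1` mod 2 and the integer determinant is odd. -/
theorem det_orderMatrix_ne_zero {N : ℕ} (hN : Even N) : (orderMatrix 𝕜 N).det ≠ 0 := by
  let Z : Matrix (Fin N) (Fin N) ℤ :=
    Matrix.of fun i j => if i < j then -1 else if j < i then 1 else 0
  have hZ : orderMatrix 𝕜 N = (1 / 2 : 𝕜) • Z.map (Int.castRingHom 𝕜) := by
    ext i j
    simp only [orderMatrix, of_apply, epsKernel, Matrix.smul_apply, map_apply, Z]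
    rcases lt_trichotomy i j with h | h | h
    · rw [Real.sign_of_neg (sub_neg.2 (by exact_mod_cast h)), if_pos h, RCLike.ofReal_div,
        RCLike.ofReal_ofNat]
      simp [neg_div]
    · simp [h]
    · rw [Real.sign_of_pos (sub_pos.2 (by exact_mod_cast h)), if_neg h.asymm, if_pos h, RCLike.ofReal_div,
        RCLike.ofReal_ofNat]
      simp
  have hdet : Z.det ≠ 0 := by
    intro h0
    let O : Matrix (Fin N) (Fin N) (ZMod 2) := Matrix.of fun _ _ => 1
    have hO : O * O = 0 := by
      ext i j
      simpa [O, mul_apply] using (ZMod.natCast_eq_zero_iff_even).2 hN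
    have hmap : Z.map (Int.castRingHom (ZMod 2)) = O - 1 := by
      ext i j
      simp only [map_apply, of_apply, Z, O, Matrix.sub_apply, Matrix.one_apply]
      rcases lt_trichotomy i j with h | h | h
      · rw [if_pos h, if_neg h.ne]; decide
      · simp [h]
      · rw [if_neg h.asymm, if_pos h, if_neg h.ne']; decide
    have h2 : (O - 1) * (O - 1) = 1 := by
      have : O + O = 0 := by
        ext i j
        change (1 : ZMod 2) + 1 = 0
        decide
      rw [sub_mul, mul_sub, mul_sub, hO]
      simp only [one_mul, mul_one, zero_sub]
      rw [sub_sub_eq_add_sub, neg_add_eq_sub, ← sub_add_eq_sub_sub_swap, this, sub_zero]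
    have h3 := congrArg det h2
    rw [det_mul, ← hmap, ← RingHom.mapMatrix_apply, ← RingHom.map_det, h0] at h3
    simp at h3
  rw [hZ, det_smul, ← RingHom.mapMatrix_apply, ← RingHom.map_det]
  refine mul_ne_zero (pow_ne_zero _ (by simp)) ?_
  simpa using hdet

/-- The value of the unnormalised Pfaffian of `ε` at increasing points. -/
noncomputable def orderConst (𝕜 : Type*) [RCLike 𝕜] (n : ℕ) : 𝕜 :=
  pfSum ((orderMatrix 𝕜 (n + n)).submatrix finSumFinEquiv finSumFinEquiv)

theorem orderConst_ne_zero (n : ℕ) : orderConst 𝕜 n ≠ 0 := by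
  have hskew : ((orderMatrix 𝕜 (n + n)).submatrix finSumFinEquiv finSumFinEquiv)ᵀ =
      -(orderMatrix 𝕜 (n + n)).submatrix finSumFinEquiv finSumFinEquiv := by
    rw [transpose_submatrix, orderMatrix_transpose]
    rfl
  have h := pfSum_sq hskew
  rw [det_submatrix_equiv_self] at h
  have hne : orderConst 𝕜 n ^ 2 ≠ 0 := by
    rw [orderConst, h]
    exact mul_ne_zero (mul_ne_zero (pow_ne_zero _ pfSum_J_ne_zero)
      (isUnit_det_J (Fin n) 𝕜).ne_zero) (det_orderMatrix_ne_zero ⟨n, rfl⟩)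
  exact fun h0 => hne (by rw [h0]; simp)

/-- At distinct points, sorting changes both factors by the sign of the sorting permutation; the
sorted Vandermonde determinant is positive and the sorted `ε` matrix does not depend on the points.
At coinciding points both sides vanish. -/
theorem det_vandermonde_mul_pfSum {n : ℕ} (x : Fin (n + n) → ℝ) :
    ((vandermonde x).det : 𝕜) * pfSum (Matrix.of fun k l : Fin n ⊕ Fin n =>
      (epsKernel (x (finSumFinEquiv k)) (x (finSumFinEquiv l)) : 𝕜)) =
    orderConst 𝕜 n * ((|(vandermonde x).det| : ℝ) : 𝕜) := by
  by_cases hx : Function.Injective x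
  · let τ := Tuple.sort x
    have hmono : StrictMono fun i => x (τ i) :=
      (Tuple.monotone_sort x).strictMono_of_injective (hx.comp τ.injective)
    let σ : Perm (Fin n ⊕ Fin n) := finSumFinEquiv.symm.permCongr τ
    have hσ := pfSum_submatrix_perm (Matrix.of fun k l : Fin n ⊕ Fin n =>
      (epsKernel (x (finSumFinEquiv k)) (x (finSumFinEquiv l)) : 𝕜)) σ
    have hsub : (Matrix.of fun k l : Fin n ⊕ Fin n =>
        (epsKernel (x (finSumFinEquiv k)) (x (finSumFinEquiv l)) : 𝕜)).submatrix σ σ =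
        (orderMatrix 𝕜 (n + n)).submatrix finSumFinEquiv finSumFinEquiv := by
      ext k l
      simp only [submatrix_apply, ← epsKernel_comp_strictMono hmono, of_apply, σ,
        Equiv.permCongr_apply, Equiv.symm_symm, Equiv.apply_symm_apply]
    rw [hsub, Perm.sign_permCongr] at hσ
    have hpos := det_vandermonde_pos hmono
    rw [det_vandermonde_comp_perm] at hpos
    rw [orderConst, hσ]
    rcases Int.units_eq_one_or (Perm.sign τ) with h | h <;> rw [h] at hpos ⊢
    · rw [abs_of_pos (by simpa using hpos)]
      simp [mul_comm]
    · rw [abs_of_neg (by simpa using hpos)]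
      simp [mul_comm]
  · have : (vandermonde x).det = 0 := by
      by_contra h
      exact hx (det_vandermonde_ne_zero_iff.1 h)
    simp [this]

theorem det_eval_eq {N : ℕ} {p : Fin N → Polynomial 𝕜}
    (hp : ∀ j : Fin N, (p j).degree = ((j : ℕ) : WithBot ℕ)) (x : Fin N → ℝ) :
    (Matrix.of fun i j => (p j).eval (x i : 𝕜)).det =
      ((vandermonde x).det : 𝕜) * ∏ j, (p j).leadingCoeff := by
  have hdeg (j : Fin N) : (p j).natDegree = j := Polynomial.natDegree_eq_of_degree_eq_some (hp j)
  rw [eval_matrixOfPolynomials_eq_vandermonde_mul_matrixOfPolynomials _ p fun j => (hdeg j).le,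
    det_mul, det_of_isUpperTriangular (M := Matrix.of fun i j : Fin N => (p j).coeff i)]
  · congr 1
    · simp only [det_vandermonde, RCLike.ofReal_prod, RCLike.ofReal_sub]
    · exact prod_congr rfl fun j _ => by simp [Polynomial.leadingCoeff, hdeg]
  · intro i j hij
    exact Polynomial.coeff_eq_zero_of_natDegree_lt (by rw [hdeg]; exact hij)

end Vandermonde

/-! ### Fredholm determinants of finite-rank kernels. -/

section Fredholm

open MeasureTheory Matrix Equiv Finset

variable {𝕜 : Type*} [RCLike 𝕜]

theorem restrict_cube (I : Set ℝ) (n : ℕ) :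
    (volume : Measure (Fin n → ℝ)).restrict (cube I n) =
      Measure.pi fun _ => volume.restrict I := by
  rw [cube, volume_pi, Measure.restrict_pi_pi]

variable {ι : Type*} [Fintype ι] {μ : Measure ℝ} [SigmaFinite μ] {a b : ι → ℝ → 𝕜}

/-- Replacing `σ` by its inverse collects the two factors evaluated at the same point `x i`, so that
each term integrates to a product of one-dimensional integrals. -/
theorem det_finiteRank_eq (a b : ι → ℝ → 𝕜) {n : ℕ} (x : Fin n → ℝ) :
    (Matrix.of fun i j => ∑ k, a k (x i) * b k (x j)).det =
      ∑ κ : Fin n → ι, ∑ σ : Perm (Fin n), ((Perm.sign σ : ℤ) : 𝕜) *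
        ∏ i, (b (κ i) (x i) * a (κ (σ i)) (x i)) := by
  rw [det_apply', sum_comm]
  refine Fintype.sum_equiv (Equiv.inv (Perm (Fin n))) _ _ fun σ => ?_
  rw [← mul_sum]
  simp only [Equiv.inv_apply, Perm.sign_inv, of_apply]
  rw [prod_univ_sum, Fintype.piFinset_univ]
  congr 1
  refine sum_congr rfl fun κ _ => ?_
  rw [prod_mul_distrib, prod_mul_distrib, mul_comm,
    ← Equiv.prod_comp σ fun i => a (κ (σ⁻¹ i)) (x i)]
  simp

theorem integrable_det_finiteRank (hab : ∀ i j, Integrable (fun x => b i x * a j x) μ) (n : ℕ) :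
    Integrable (fun x : Fin n → ℝ => (Matrix.of fun i j => ∑ k, a k (x i) * b k (x j)).det)
      (Measure.pi fun _ => μ) := by
  simp_rw [det_finiteRank_eq]
  exact integrable_finsetSum _ fun κ _ => integrable_finsetSum _ fun σ _ =>
    (Integrable.fintype_prod (f := fun i x => b (κ i) x * a (κ (σ i)) x)
      fun i => hab _ _).const_mul _

theorem integral_det_finiteRank (hab : ∀ i j, Integrable (fun x => b i x * a j x) μ) (n : ℕ) :
    ∫ x : Fin n → ℝ, (Matrix.of fun i j => ∑ k, a k (x i) * b k (x j)).det
      ∂Measure.pi (fun _ => μ) =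
    ∑ κ : Fin n → ι,
      ((Matrix.of fun i j => ∫ x, b i x * a j x ∂μ).submatrix κ κ).det := by
  simp_rw [det_finiteRank_eq]
  have hint (κ : Fin n → ι) (σ : Perm (Fin n)) : Integrable (fun x : Fin n → ℝ =>
      ((Perm.sign σ : ℤ) : 𝕜) * ∏ i, (b (κ i) (x i) * a (κ (σ i)) (x i)))
      (Measure.pi fun _ => μ) :=
    (Integrable.fintype_prod (f := fun i x => b (κ i) x * a (κ (σ i)) x)
      fun i => hab _ _).const_mul _
  rw [integral_finsetSum _ fun κ _ => integrable_finsetSum _ fun σ _ => hint κ σ]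
  refine sum_congr rfl fun κ _ => ?_
  rw [integral_finsetSum _ fun σ _ => hint κ σ, ← det_transpose, det_apply']
  refine sum_congr rfl fun σ _ => ?_
  rw [integral_const_mul,
    integral_fintype_prod_eq_prod fun i x => b (κ i) x * a (κ (σ i)) x]
  rfl

variable [DecidableEq ι]

theorem sum_injective_eq_sum_equiv {R : Type*} [CommRing R] (G : Matrix ι ι R) {n : ℕ}
    {s : Finset ι} (hs : #s = n) :
    ∑ κ : Fin n → ι with Function.Injective κ ∧ univ.image κ = s, (G.submatrix κ κ).det =
      n.factorial * (G.submatrix (Subtype.val : s → ι) (Subtype.val : s → ι)).det := by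
  have e₀ : Fin n ≃ s := (s.equivFinOfCardEq hs).symm
  have h : ∑ e : Fin n ≃ s, (G.submatrix (fun i => (e i : ι)) fun i => (e i : ι)).det =
      ∑ κ : Fin n → ι with Function.Injective κ ∧ univ.image κ = s, (G.submatrix κ κ).det := by
    refine sum_bij (fun e _ => fun i => (e i : ι)) (fun e _ => ?_) (fun e _ e' _ h => ?_)
      (fun κ hκ => ?_) fun _ _ => rfl
    · rw [mem_filter]
      refine ⟨mem_univ _, Subtype.val_injective.comp e.injective, ?_⟩
      ext x
      simp only [mem_image, mem_univ, true_and]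
      exact ⟨fun ⟨i, hi⟩ => hi ▸ (e i).2, fun hx => ⟨e.symm ⟨x, hx⟩, by simp⟩⟩
    · ext i
      exact congrFun h i
    · obtain ⟨hinj, himg⟩ := (mem_filter.1 hκ).2
      have hmem (i : Fin n) : κ i ∈ s := himg ▸ mem_image_of_mem _ (mem_univ i)
      refine ⟨Equiv.ofBijective (fun i => ⟨κ i, hmem i⟩)
        ⟨fun i j hij => hinj (congrArg Subtype.val hij), fun x => ?_⟩, mem_univ _, rfl⟩
      obtain ⟨i, -, hi⟩ := mem_image.1 (himg.symm ▸ x.2 : (x : ι) ∈ univ.image κ)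
      exact ⟨i, Subtype.ext hi⟩
  have hdet (e : Fin n ≃ s) : (G.submatrix (fun i => (e i : ι)) fun i => (e i : ι)).det =
      (G.submatrix (Subtype.val : s → ι) (Subtype.val : s → ι)).det :=
    det_submatrix_equiv_self e (G.submatrix (Subtype.val : s → ι) Subtype.val)
  rw [← h, sum_congr rfl fun e _ => hdet e, sum_const, card_univ, Fintype.card_equiv e₀,
    Fintype.card_fin, nsmul_eq_mul]

/-- Non-injective `κ` repeat a column. Injective ones, grouped by image, give each principal minor
of size `n` exactly `n!` times, and the sum of these minors is the coefficient. -/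
theorem sum_det_submatrix {R : Type*} [CommRing R] (G : Matrix ι ι R) (n : ℕ) :
    ∑ κ : Fin n → ι, (G.submatrix κ κ).det =
      n.factorial * (det (1 + (Polynomial.X : Polynomial R) • G.map Polynomial.C)).coeff n := by
  rw [coeff_det_one_add_X_smul_eq_sum_minors, mul_sum,
    ← sum_congr rfl fun s hs => sum_injective_eq_sum_equiv G (mem_powersetCard.1 hs).2]
  rw [← sum_filter_add_sum_filter_not univ Function.Injective,
    sum_eq_zero (s := filter (fun κ : Fin n → ι => ¬ Function.Injective κ) univ), add_zero,
    ← sum_fiberwise_of_maps_to (g := fun κ => univ.image κ) (t := univ.powersetCard n)]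
  · simp_rw [filter_filter]
  · intro κ hκ
    rw [mem_powersetCard]
    exact ⟨subset_univ _, by rw [card_image_of_injective _ (mem_filter.1 hκ).2]; simp⟩
  · intro κ hκ
    have hκ' := (mem_filter.1 hκ).2
    unfold Function.Injective at hκ'
    push Not at hκ'
    obtain ⟨i, j, hij, hne⟩ := hκ'
    exact det_zero_of_column_eq hne fun k => by simp [hij]

/-- The terms are the coefficients of the polynomial `det (1 + X G)`, evaluated at `X = 1`. -/
theorem hasSum_sum_det_submatrix (G : Matrix ι ι 𝕜) :
    HasSum (fun n : ℕ => (n.factorial : 𝕜)⁻¹ * ∑ κ : Fin n → ι, (G.submatrix κ κ).det)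
      (1 + G).det := by
  let P := det (1 + (Polynomial.X : Polynomial 𝕜) • G.map Polynomial.C)
  have hterm (n : ℕ) : (n.factorial : 𝕜)⁻¹ * ∑ κ : Fin n → ι, (G.submatrix κ κ).det =
      P.coeff n := by
    rw [sum_det_submatrix, inv_mul_cancel_left₀ (Nat.cast_ne_zero.2 n.factorial_ne_zero)]
  have heval : (1 + G).det = P.eval 1 := by
    rw [← Polynomial.coe_evalRingHom, RingHom.map_det]
    congr 1
    ext i j
    simp [Matrix.one_apply, apply_ite (Polynomial.eval (1 : 𝕜))]
  simp_rw [hterm]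
  rw [heval, Polynomial.eval_eq_sum, Polynomial.sum]
  simp only [one_pow, mul_one]
  exact hasSum_sum_of_ne_finset_zero fun n hn => Polynomial.notMem_support_iff.1 hn

theorem isFredholmDet_finiteRank {I : Set ℝ} {T : ℝ → ℝ → 𝕜}
    (hT : ∀ x y, T x y = ∑ k, a k x * b k y)
    (hab : ∀ i j, IntegrableOn (fun x => b i x * a j x) I) :
    IsFredholmDet I T (1 + Matrix.of fun i j => ∫ x in I, b i x * a j x).det := by
  have hdet (n : ℕ) (x : Fin n → ℝ) : (Matrix.of fun i j => T (x i) (x j)).det =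
      (Matrix.of fun i j => ∑ k, a k (x i) * b k (x j)).det := by simp_rw [hT]
  refine ⟨fun n => ?_, ?_⟩
  · simp_rw [IntegrableOn, restrict_cube, hdet]
    exact integrable_det_finiteRank hab n
  · simp_rw [restrict_cube, hdet, integral_det_finiteRank hab]
    exact hasSum_sum_det_submatrix _

end Fredholm

/-! ### The commutator identity for `ε` and multiplication by `f`. -/

section Calculus

open MeasureTheory Set Filter Topology

variable {𝕜 : Type*} [RCLike 𝕜]

theorem ordConnected_interval (a b : EReal) : (interval a b).OrdConnected :=
  ⟨fun _ hx _ hy _ hz => ⟨hx.1.trans (EReal.coe_le_coe_iff.2 hz.1),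
    (EReal.coe_le_coe_iff.2 hz.2).trans hy.2⟩⟩

theorem measurableSet_interval (a b : EReal) : MeasurableSet (interval a b) :=
  (ordConnected_interval a b).measurableSet

theorem measurable_sign : Measurable Real.sign := by
  unfold Real.sign
  exact Measurable.ite measurableSet_Iio measurable_const
    (Measurable.ite measurableSet_Ioi measurable_const measurable_const)

theorem measurable_epsKernel :
    Measurable (Function.uncurry (epsKernel : ℝ → ℝ → 𝕜)) :=
  RCLike.measurable_ofReal.comp
    ((measurable_sign.comp (measurable_fst.sub measurable_snd)).div_const 2)

theorem norm_epsKernel_le (x y : ℝ) : ‖(epsKernel x y : 𝕜)‖ ≤ 1 := by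
  rw [epsKernel, RCLike.norm_ofReal]
  rcases Real.sign_apply_eq (x - y) with h | h | h <;> rw [h] <;> norm_num

theorem hasDerivAt_schwartz (f : SchwartzMap ℝ 𝕜) (x : ℝ) : HasDerivAt f (deriv f x) x :=
  f.differentiableAt.hasDerivAt

theorem integrable_deriv_schwartz (f : SchwartzMap ℝ 𝕜) : Integrable (deriv f) :=
  (SchwartzMap.derivCLM ℝ 𝕜 f).integrable

theorem exists_norm_le_schwartz (f : SchwartzMap ℝ 𝕜) : ∃ C, ∀ x, ‖f x‖ ≤ C :=
  ⟨_, fun x => f.norm_le_seminorm ℝ x⟩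

theorem tendsto_atTop_schwartz (f : SchwartzMap ℝ 𝕜) : Tendsto f atTop (𝓝 0) :=
  f.tendsto_cocompact.mono_left _root_.atTop_le_cocompact

theorem tendsto_atBot_schwartz (f : SchwartzMap ℝ 𝕜) : Tendsto f atBot (𝓝 0) :=
  f.tendsto_cocompact.mono_left _root_.atBot_le_cocompact

theorem setIntegral_deriv_Ioc (f : SchwartzMap ℝ 𝕜) {x y : ℝ} (h : x ≤ y) :
    ∫ z in Ioc x y, deriv f z = f y - f x := by
  rw [← intervalIntegral.integral_of_le h]
  exact intervalIntegral.integral_eq_sub_of_hasDerivAt (fun z _ => hasDerivAt_schwartz f z)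
    (integrable_deriv_schwartz f).intervalIntegrable

/-- Here the endpoint condition does its work. The order of `a` and `b` is arbitrary, so empty
intervals occur among the cases. -/
theorem setIntegral_deriv_interval {a b : EReal} (f : SchwartzMap ℝ 𝕜)
    (hf : endValue f a = endValue f b) : ∫ x in interval a b, deriv f x = 0 := by
  have hd := fun x => hasDerivAt_schwartz f x
  have hi := integrable_deriv_schwartz f
  induction a with
  | top =>
    have : interval ⊤ b = ∅ := by ext; simp [interval]
    simp [this]
  | bot =>
    induction b with
    | bot =>
      have : interval ⊥ ⊥ = ∅ := by ext; simp [interval]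
      simp [this]
    | top =>
      have : interval ⊥ ⊤ = univ := by ext; simp [interval]
      rw [this, setIntegral_univ, integral_of_hasDerivAt_of_tendsto hd hi
        (tendsto_atBot_schwartz f) (tendsto_atTop_schwartz f), sub_self]
    | coe b =>
      have : interval ⊥ b = Iic b := by ext; simp [interval]
      rw [this, integral_Iic_of_hasDerivAt_of_tendsto' (fun x _ => hd x) hi.integrableOn
        (tendsto_atBot_schwartz f)]
      simpa [endValue, eq_comm] using hf
  | coe a =>
    induction b with
    | bot =>
      have : interval a ⊥ = ∅ := by ext; simp [interval]
      simp [this]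
    | top =>
      have : interval a ⊤ = Ici a := by ext; simp [interval]
      rw [this, integral_Ici_eq_integral_Ioi, integral_Ioi_of_hasDerivAt_of_tendsto'
        (fun x _ => hd x) hi.integrableOn (tendsto_atTop_schwartz f)]
      simpa [endValue] using hf
    | coe b =>
      have : interval a b = Icc a b := by ext; simp [interval]
      rw [this]
      rcases le_or_gt a b with h | h
      · rw [integral_Icc_eq_integral_Ioc, setIntegral_deriv_Ioc f h]
        exact sub_eq_zero.2 (by simpa [endValue] using hf.symm)
      · simp [Icc_eq_empty h.not_ge]

/-- The product of signs is `1/4` between `y` and `x` and `-1/4` outside. Splitting off the constant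
`-1/4` isolates a term that integrates to zero when `c = f'(z)`. -/
theorem epsKernel_mul_epsKernel {x y z : ℝ} (hyx : y ≤ x) (hzx : z ≠ x) (hzy : z ≠ y) (c : 𝕜) :
    epsKernel x z * (c * epsKernel z y) =
      -(1 / 4) * c + (1 / 2) * (Ioc y x).indicator (fun _ => c) z := by
  simp only [epsKernel, RCLike.ofReal_div, RCLike.ofReal_ofNat]
  rcases hzx.lt_or_gt with h1 | h1
  · rcases hzy.lt_or_gt with h2 | h2
    · rw [indicator_of_notMem (fun h => h2.not_gt h.1), Real.sign_of_pos (sub_pos.2 h1),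
        Real.sign_of_neg (sub_neg.2 h2)]
      simp only [RCLike.ofReal_neg, RCLike.ofReal_one]
      ring
    · rw [indicator_of_mem (show z ∈ Ioc y x from ⟨h2, h1.le⟩), Real.sign_of_pos (sub_pos.2 h1),
        Real.sign_of_pos (sub_pos.2 h2)]
      simp only [RCLike.ofReal_one]
      ring
  · rw [indicator_of_notMem (fun h => h1.not_ge h.2), Real.sign_of_neg (sub_neg.2 h1),
      Real.sign_of_pos (sub_pos.2 (hyx.trans_lt h1))]
    simp only [RCLike.ofReal_neg, RCLike.ofReal_one]
    ring

theorem integral_eps_deriv_eps_of_le {a b : EReal} {f : SchwartzMap ℝ 𝕜}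
    (hf : endValue f a = endValue f b) {x y : ℝ} (hx : x ∈ interval a b) (hy : y ∈ interval a b)
    (hyx : y ≤ x) :
    ∫ z in interval a b, epsKernel x z * (deriv f z * epsKernel z y) =
      (f x - f y) * (1 / 2) := by
  have hi := integrable_deriv_schwartz f
  have hae : ∀ᵐ z ∂volume.restrict (interval a b),
      epsKernel x z * (deriv f z * epsKernel z y) =
        -(1 / 4) * deriv f z + (1 / 2) * (Ioc y x).indicator (deriv f) z := by
    refine ae_restrict_of_ae ?_
    filter_upwards [compl_mem_ae_iff.2 (measure_singleton x),
      compl_mem_ae_iff.2 (measure_singleton y)] with z hzx hzy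
    exact epsKernel_mul_epsKernel hyx hzx hzy _
  rw [integral_congr_ae hae, integral_add (hi.integrableOn.const_mul _)
    ((hi.indicator measurableSet_Ioc).integrableOn.const_mul _), integral_const_mul,
    integral_const_mul, setIntegral_deriv_interval f hf, setIntegral_indicator measurableSet_Ioc,
    inter_eq_self_of_subset_right, setIntegral_deriv_Ioc f hyx]
  · ring
  · exact Ioc_subset_Icc_self.trans ((ordConnected_interval a b).out hy hx)

/-- This is `ε f' ε = f ε - ε f` at the level of kernels. The case `x < y` follows from the other by
antisymmetry of `ε`. -/
theorem integral_eps_deriv_eps {a b : EReal} {f : SchwartzMap ℝ 𝕜}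
    (hf : endValue f a = endValue f b) {x y : ℝ} (hx : x ∈ interval a b)
    (hy : y ∈ interval a b) :
    ∫ z in interval a b, epsKernel x z * (deriv f z * epsKernel z y) =
      (f x - f y) * epsKernel x y := by
  rcases lt_trichotomy y x with h | h | h
  · rw [integral_eps_deriv_eps_of_le hf hx hy h.le, epsKernel, Real.sign_of_pos (sub_pos.2 h),
      RCLike.ofReal_div, RCLike.ofReal_ofNat, RCLike.ofReal_one]
  · rw [integral_eps_deriv_eps_of_le hf hx hy h.le, h]
    simp
  · have := integral_eps_deriv_eps_of_le hf hy hx h.le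
    simp_rw [epsKernel_comm (𝕜 := 𝕜) x, epsKernel_comm (𝕜 := 𝕜) _ y]
    rw [epsKernel, Real.sign_of_pos (sub_pos.2 h), RCLike.ofReal_div, RCLike.ofReal_ofNat,
      RCLike.ofReal_one]
    simp only [mul_neg, neg_mul, neg_neg]
    rw [integral_congr_ae (ae_of_all _ fun z => show epsKernel z x * (deriv f z * epsKernel y z) =
      epsKernel y z * (deriv f z * epsKernel z x) by ring), this]
    ring

end Calculus

/-! ### The operator `ε` on integrable functions and the perturbed skew form. -/

section EpsOperator

open MeasureTheory

variable {𝕜 : Type*} [RCLike 𝕜] {I : Set ℝ} {g h : ℝ → 𝕜}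

theorem integrable_mul_epsKernel (hg : IntegrableOn g I) (y : ℝ) :
    IntegrableOn (fun x => g x * epsKernel x y) I :=
  hg.mul_bdd (c := 1) (measurable_epsKernel.comp
    (f := fun x : ℝ => (x, y)) (by fun_prop)).aestronglyMeasurable
    (ae_of_all _ fun _ => norm_epsKernel_le _ _)

theorem integrable_epsKernel_mul (hg : IntegrableOn g I) (x : ℝ) :
    IntegrableOn (fun y => epsKernel x y * g y) I :=
  hg.bdd_mul (c := 1) (measurable_epsKernel.comp
    (f := fun y : ℝ => (x, y)) (by fun_prop)).aestronglyMeasurable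
    (ae_of_all _ fun _ => norm_epsKernel_le _ _)

theorem integrable_prod_epsKernel (hg : IntegrableOn g I) (hh : IntegrableOn h I) :
    Integrable (Function.uncurry fun x y => g x * (epsKernel x y * h y))
      ((volume.restrict I).prod (volume.restrict I)) := by
  have := (hg.mul_prod hh).bdd_mul (c := 1)
    (f := fun p : ℝ × ℝ => (epsKernel p.1 p.2 : 𝕜)) measurable_epsKernel.aestronglyMeasurable
    (ae_of_all _ fun _ => norm_epsKernel_le _ _)
  refine this.congr (ae_of_all _ fun p => ?_)
  simp only [Function.uncurry]
  ring

theorem norm_eps_le (hg : IntegrableOn g I) (x : ℝ) : ‖eps I g x‖ ≤ ∫ t in I, ‖g t‖ := by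
  refine (norm_integral_le_integral_norm _).trans
    (integral_mono (integrable_epsKernel_mul hg x).norm hg.norm fun t => ?_)
  simp only [norm_mul]
  exact mul_le_of_le_one_left (norm_nonneg _) (norm_epsKernel_le _ _)

theorem aestronglyMeasurable_eps (hg : IntegrableOn g I) :
    AEStronglyMeasurable (eps I g) (volume.restrict I) := by
  refine AEStronglyMeasurable.integral_prod_right' (μ := volume.restrict I)
    (ν := volume.restrict I) (f := fun p : ℝ × ℝ => epsKernel p.1 p.2 * g p.2) ?_
  exact measurable_epsKernel.aestronglyMeasurable.mul hg.aestronglyMeasurable.comp_snd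

theorem integrable_mul_eps (hg : IntegrableOn g I) (hh : IntegrableOn h I) :
    IntegrableOn (fun x => g x * eps I h x) I :=
  hg.mul_bdd (aestronglyMeasurable_eps hh) (ae_of_all _ (norm_eps_le hh))

theorem integral_mul_eps (hg : IntegrableOn g I) (hh : IntegrableOn h I) :
    ∫ x in I, g x * eps I h x = ∫ y in I, (∫ x in I, g x * epsKernel x y) * h y := by
  simp_rw [eps, ← integral_const_mul]
  rw [integral_integral_swap (integrable_prod_epsKernel hg hh)]
  simp_rw [← integral_mul_const, mul_assoc]

theorem integral_mul_epsKernel (g : ℝ → 𝕜) (y : ℝ) :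
    ∫ x in I, g x * epsKernel x y = -eps I g y := by
  rw [eps, ← integral_neg]
  exact integral_congr_ae (ae_of_all _ fun x => by
    simp only
    rw [epsKernel_comm]
    ring)

theorem integral_mul_eps_comm (hg : IntegrableOn g I) (hh : IntegrableOn h I) :
    ∫ x in I, g x * eps I h x = -∫ x in I, h x * eps I g x := by
  rw [integral_mul_eps hg hh, ← integral_neg]
  refine integral_congr_ae (ae_of_all _ fun x => ?_)
  simp only [integral_mul_epsKernel]
  ring

theorem integrable_schwartz_mul (f : SchwartzMap ℝ 𝕜) (hg : IntegrableOn g I) :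
    IntegrableOn (fun x => f x * g x) I := by
  obtain ⟨C, hC⟩ := exists_norm_le_schwartz f
  exact hg.bdd_mul f.continuous.aestronglyMeasurable (ae_of_all _ hC)

theorem eps_mul_eq {a b : EReal} {f : SchwartzMap ℝ 𝕜} (hf : endValue f a = endValue f b)
    (hg : IntegrableOn g (interval a b)) {x : ℝ} (hx : x ∈ interval a b) :
    eps (interval a b) (fun t => f t * g t) x = f x * eps (interval a b) g x -
      eps (interval a b) (fun t => deriv f t * eps (interval a b) g t) x := by
  have hi : IntegrableOn (deriv f) (interval a b) := (integrable_deriv_schwartz f).integrableOn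
  have h1 : eps (interval a b) (fun t => deriv f t * eps (interval a b) g t) x =
      ∫ y in interval a b, (f x - f y) * epsKernel x y * g y := by
    have h2 := integral_mul_eps (g := fun z => epsKernel x z * deriv f z)
      (integrable_epsKernel_mul hi x) hg
    rw [eps]
    simp_rw [← mul_assoc]
    rw [h2]
    refine setIntegral_congr_fun (measurableSet_interval a b) fun y hy => ?_
    simp only [← integral_eps_deriv_eps hf hx hy, mul_assoc]
  have h3 : eps (interval a b) (fun t => deriv f t * eps (interval a b) g t) x =
      f x * eps (interval a b) g x - eps (interval a b) (fun t => f t * g t) x := by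
    rw [h1, eps, eps, ← integral_const_mul, ← integral_sub
      ((integrable_epsKernel_mul hg x).const_mul _)
      (integrable_epsKernel_mul (integrable_schwartz_mul f hg) x)]
    exact integral_congr_ae (ae_of_all _ fun y => by simp only; ring)
  rw [h3]
  ring

/-- The row vector `g` times the operator whose Fredholm determinant is taken: multiplication by
`f ^ 2 + 2 f`, minus `ε` and `f ε`, each after multiplication by the derivative of `f`. -/
noncomputable def rowFun (I : Set ℝ) (f g : ℝ → 𝕜) (y : ℝ) : 𝕜 :=
  g y * (f y ^ 2 + 2 * f y) - (∫ z in I, g z * epsKernel z y) * deriv f y -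
    (∫ z in I, g z * f z * epsKernel z y) * deriv f y

theorem integrable_deriv_mul_eps (f : SchwartzMap ℝ 𝕜) (hg : IntegrableOn g I) :
    IntegrableOn (fun x => deriv f x * eps I g x) I :=
  integrable_mul_eps (integrable_deriv_schwartz f).integrableOn hg

theorem rowFun_eq (f g : ℝ → 𝕜) (y : ℝ) : rowFun I f g y =
    f y * (f y * g y) + 2 * (f y * g y) + deriv f y * eps I g y +
      deriv f y * eps I (fun t => f t * g t) y := by
  rw [rowFun, integral_mul_epsKernel, integral_mul_epsKernel fun z => g z * f z]
  simp_rw [mul_comm (g _) (f _)]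
  ring

theorem integrable_rowFun (f : SchwartzMap ℝ 𝕜) (hg : IntegrableOn g I) :
    IntegrableOn (rowFun I f g) I := by
  have hfg := integrable_schwartz_mul f hg
  simp_rw [funext (rowFun_eq (I := I) f g)]
  exact (((integrable_schwartz_mul f hfg).add (hfg.const_mul 2)).add
    (integrable_deriv_mul_eps f hg)).add (integrable_deriv_mul_eps f hfg)

/-- The commutator identity, applied to the right factor only, gives `ε (1 + f) h = (1 + f) εh - ε
f' εh`. Moving the outer `ε` onto `g (1 + f)` by Fubini leaves `εh` as a common right factor, and
its coefficient is `g + rowFun I f g`. -/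
theorem integral_perturbed {a b : EReal} {f : SchwartzMap ℝ 𝕜}
    (hf : endValue f a = endValue f b)
    (hg : IntegrableOn g (interval a b)) (hh : IntegrableOn h (interval a b)) :
    ∫ x in interval a b, (g x * (1 + f x)) * eps (interval a b) (fun t => h t * (1 + f t)) x =
      (∫ x in interval a b, g x * eps (interval a b) h x) +
        ∫ x in interval a b, rowFun (interval a b) f g x * eps (interval a b) h x := by
  set I := interval a b
  have hfg := integrable_schwartz_mul f hg
  have hfh := integrable_schwartz_mul f hh
  have hdh := integrable_deriv_mul_eps f hh
  have hu : IntegrableOn (fun x => g x * (1 + f x)) I :=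
    (hg.add hfg).congr (ae_of_all _ fun x => by simp only [Pi.add_apply]; ring)
  have h1 (x : ℝ) (hx : x ∈ I) : eps I (fun t => h t * (1 + f t)) x =
      (1 + f x) * eps I h x - eps I (fun t => deriv f t * eps I h t) x := by
    have : eps I (fun t => h t * (1 + f t)) x = eps I h x + eps I (fun t => f t * h t) x := by
      rw [eps, eps, eps, ← integral_add (integrable_epsKernel_mul hh x)
        (integrable_epsKernel_mul hfh x)]
      exact integral_congr_ae (ae_of_all _ fun t => by simp only; ring)
    rw [this, eps_mul_eq hf hh hx]
    ring
  have hsq : IntegrableOn (fun x => (1 + f x) * (g x * (1 + f x))) I :=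
    (hu.add (integrable_schwartz_mul f hu)).congr
      (ae_of_all _ fun x => by simp only [Pi.add_apply]; ring)
  have h2 : ∫ x in I, (g x * (1 + f x)) * eps I (fun t => h t * (1 + f t)) x =
      (∫ x in I, (1 + f x) * (g x * (1 + f x)) * eps I h x) -
        ∫ x in I, (g x * (1 + f x)) * eps I (fun t => deriv f t * eps I h t) x := by
    rw [← integral_sub (integrable_mul_eps hsq hh) (integrable_mul_eps hu hdh)]
    refine setIntegral_congr_fun (measurableSet_interval a b) fun x hx => ?_
    simp only [h1 x hx]
    ring
  have h3 : (∫ x in I, (g x * (1 + f x)) * eps I (fun t => deriv f t * eps I h t) x) =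
      ∫ x in I, -(eps I g x + eps I (fun t => f t * g t) x) * (deriv f x * eps I h x) := by
    rw [integral_mul_eps hu hdh]
    refine integral_congr_ae (ae_of_all _ fun y => ?_)
    simp only [integral_mul_epsKernel]
    congr 2
    rw [eps, eps, eps, ← integral_add (integrable_epsKernel_mul hg y)
      (integrable_epsKernel_mul hfg y)]
    exact integral_congr_ae (ae_of_all _ fun t => by simp only; ring)
  have hrest : IntegrableOn
      (fun x => -(eps I g x + eps I (fun t => f t * g t) x) * (deriv f x * eps I h x)) I := by
    have i1 := hdh.mul_bdd (aestronglyMeasurable_eps hg) (ae_of_all _ (norm_eps_le hg))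
    have i2 := hdh.mul_bdd (aestronglyMeasurable_eps hfg) (ae_of_all _ (norm_eps_le hfg))
    exact (i1.add i2).neg.congr (ae_of_all _ fun x => by
      simp only [Pi.add_apply, Pi.neg_apply]; ring)
  rw [h2, h3, ← integral_sub (integrable_mul_eps hsq hh) hrest,
    ← integral_add (integrable_mul_eps hg hh) (integrable_mul_eps (integrable_rowFun f hg) hh)]
  refine integral_congr_ae (ae_of_all _ fun x => ?_)
  simp only [rowFun_eq]
  ring

end EpsOperator

/-! ### Absolute convergence and positivity of the normalisation. -/

section Integrability

open MeasureTheory Matrix Equiv Finset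

variable {𝕜 : Type*} [RCLike 𝕜] {I : Set ℝ}

theorem integrable_det_vandermonde_mul_prod {u : ℝ → 𝕜}
    (hu : ∀ n : ℕ, IntegrableOn (fun x : ℝ => (x : 𝕜) ^ n * u x) I) (N : ℕ) :
    IntegrableOn (fun x : Fin N → ℝ => ((vandermonde x).det : 𝕜) * ∏ j, u (x j)) (cube I N) := by
  have h (x : Fin N → ℝ) : ((vandermonde x).det : 𝕜) * ∏ j, u (x j) =
      ∑ σ : Perm (Fin N), ((Perm.sign σ : ℤ) : 𝕜) *
        ∏ i, ((x i : 𝕜) ^ ((σ i : Fin N) : ℕ) * u (x i)) := by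
    rw [← det_transpose, det_apply', RCLike.ofReal_sum, sum_mul]
    refine sum_congr rfl fun σ _ => ?_
    simp only [transpose_apply, vandermonde_apply, RCLike.ofReal_mul, RCLike.ofReal_prod,
      RCLike.ofReal_pow, prod_mul_distrib, RCLike.ofReal_intCast]
    ring
  simp_rw [h, IntegrableOn, restrict_cube]
  exact integrable_finsetSum _ fun σ _ => (Integrable.fintype_prod
    (f := fun i (x : ℝ) => (x : 𝕜) ^ ((σ i : Fin N) : ℕ) * u x) fun i => hu _).const_mul _

theorem integrable_abs_det_vandermonde_mul_prod {u : ℝ → 𝕜}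
    (hu : ∀ n : ℕ, IntegrableOn (fun x : ℝ => (x : 𝕜) ^ n * u x) I) (N : ℕ) :
    IntegrableOn (fun x : Fin N → ℝ => ((|(vandermonde x).det| : ℝ) : 𝕜) * ∏ j, u (x j))
      (cube I N) := by
  -- The absolute value is the determinant times its sign, a bounded measurable factor.
  have hmeas : Measurable fun x : Fin N → ℝ => ((Real.sign (vandermonde x).det : ℝ) : 𝕜) := by
    refine RCLike.measurable_ofReal.comp (measurable_sign.comp ?_)
    simp_rw [det_vandermonde]
    fun_prop
  refine ((integrable_det_vandermonde_mul_prod hu N).bdd_mul (c := 1) hmeas.aestronglyMeasurable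
    (ae_of_all _ fun x => ?_)).congr (ae_of_all _ fun x => ?_)
  · rw [RCLike.norm_ofReal]
    rcases Real.sign_apply_eq (vandermonde x).det with h | h | h <;> rw [h] <;> norm_num
  · simp only
    rw [← mul_assoc, ← RCLike.ofReal_mul]
    congr 2
    rcases lt_trichotomy (vandermonde x).det 0 with h | h | h
    · rw [Real.sign_of_neg h, abs_of_neg h, neg_one_mul]
    · simp [h]
    · rw [Real.sign_of_pos h, abs_of_pos h, one_mul]

theorem integrable_eval_mul {u : ℝ → 𝕜}
    (hu : ∀ n : ℕ, IntegrableOn (fun x : ℝ => (x : 𝕜) ^ n * u x) I) (q : Polynomial 𝕜) :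
    IntegrableOn (fun x : ℝ => q.eval (x : 𝕜) * u x) I := by
  simp_rw [Polynomial.eval_eq_sum_range, sum_mul, mul_assoc]
  exact integrable_finsetSum _ fun n _ => (hu n).const_mul _

theorem IsWeight.integrable_pow_mul {w : ℝ → ℝ} (hw : IsWeight I w) (n : ℕ) :
    IntegrableOn (fun x : ℝ => (x : 𝕜) ^ n * (w x : 𝕜)) I := by
  simpa only [RCLike.ofReal_mul, RCLike.ofReal_pow] using! (hw.moments n).ofReal (𝕜 := 𝕜)

theorem IsWeight.integrable_pow_mul_one_add {w : ℝ → ℝ} (hw : IsWeight I w)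
    (f : SchwartzMap ℝ 𝕜) (n : ℕ) :
    IntegrableOn (fun x : ℝ => (x : 𝕜) ^ n * ((w x : 𝕜) * (1 + f x))) I := by
  have h := hw.integrable_pow_mul (𝕜 := 𝕜) n
  exact (h.add (integrable_schwartz_mul f h)).congr
    (ae_of_all _ fun x => by simp only [Pi.add_apply]; ring)

theorem density_eq (w : ℝ → ℝ) (N : ℕ) (x : Fin N → ℝ) :
    density w N x = |(vandermonde x).det| * ∏ j, w (x j) := by
  rw [density, prod_abs_sub_eq_abs_det_vandermonde]

theorem genIntegrand_eq (w : ℝ → ℝ) (N : ℕ) (f : ℝ → 𝕜) (x : Fin N → ℝ) :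
    genIntegrand w N f x =
      ((|(vandermonde x).det| : ℝ) : 𝕜) * ∏ j, ((w (x j) : 𝕜) * (1 + f (x j))) := by
  rw [genIntegrand, density_eq, prod_mul_distrib, RCLike.ofReal_mul, RCLike.ofReal_prod, mul_assoc]

theorem IsWeight.integrable_genIntegrand {w : ℝ → ℝ} (hw : IsWeight I w) (N : ℕ)
    (f : SchwartzMap ℝ 𝕜) : IntegrableOn (genIntegrand w N f) (cube I N) := by
  simp_rw [funext (genIntegrand_eq w N f)]
  exact integrable_abs_det_vandermonde_mul_prod (hw.integrable_pow_mul_one_add f) N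

theorem IsWeight.integrable_density {w : ℝ → ℝ} (hw : IsWeight I w) (N : ℕ) :
    IntegrableOn (density w N) (cube I N) := by
  simp_rw [funext (density_eq w N)]
  exact integrable_abs_det_vandermonde_mul_prod (𝕜 := ℝ) (hw.integrable_pow_mul (𝕜 := ℝ)) N

theorem ae_injective (N : ℕ) : ∀ᵐ x : Fin N → ℝ, Function.Injective x := by
  have h (i j : Fin N) (hij : i ≠ j) : ∀ᵐ x : Fin N → ℝ, x i ≠ x j := by
    let V : Submodule ℝ (Fin N → ℝ) :=
      LinearMap.ker (LinearMap.proj (R := ℝ) (φ := fun _ : Fin N => ℝ) i - LinearMap.proj j)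
    have hV : V ≠ ⊤ := by
      intro h
      have : Pi.single i (1 : ℝ) ∈ V := h ▸ Submodule.mem_top
      simp [V, hij.symm] at this
    refine measure_mono_null (fun x hx => ?_) (Measure.addHaar_submodule volume V hV)
    have : x i = x j := by simpa using hx
    simp [V, this]
  have h' : ∀ᵐ x : Fin N → ℝ, ∀ i j, i ≠ j → x i ≠ x j :=
    ae_all_iff.2 fun i => ae_all_iff.2 fun j => by
      by_cases hij : i = j
      · simp [hij]
      · filter_upwards [h i j hij] with x hx _ using hx
  filter_upwards [h'] with x hx i j hij
  by_contra hne
  exact hx i j hne hij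

/-- Almost every point has distinct coordinates, so the density is nonzero almost everywhere on the
`N`-fold product of the support of `w`, a set of positive measure. -/
theorem IsWeight.partitionFunction_pos {w : ℝ → ℝ} (hI : MeasurableSet I) (hw : IsWeight I w)
    (N : ℕ) : 0 < partitionFunction I w N := by
  have hint := hw.integrable_density N
  have hcube : MeasurableSet (cube I N) := MeasurableSet.univ_pi fun _ => hI
  have hnonneg : 0 ≤ᵐ[volume.restrict (cube I N)] density w N := by
    filter_upwards [ae_restrict_mem hcube] with x hx
    rw [density_eq]
    exact mul_nonneg (abs_nonneg _) (prod_nonneg fun j _ => hw.nonneg _ (hx j trivial))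
  rw [partitionFunction, integral_pos_iff_support_of_nonneg_ae hnonneg hint]
  have hw0 : IntegrableOn w I := by simpa using hw.moments 0
  have hpos : 0 < (volume.restrict I) (Function.support w) := by
    rw [← integral_pos_iff_support_of_nonneg_ae _ hw0]
    · exact hw.pos
    · filter_upwards [ae_restrict_mem hI] with x hx using hw.nonneg x hx
  have hpi : 0 < (volume.restrict (cube I N)) (Set.univ.pi fun _ => Function.support w) := by
    rw [restrict_cube, Measure.pi_pi]
    exact pos_iff_ne_zero.2 (prod_ne_zero_iff.2 fun _ _ => hpos.ne')
  refine hpi.trans_le (measure_mono_ae ?_)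
  filter_upwards [ae_restrict_of_ae (ae_injective N)] with x hx hxw
  change density w N x ≠ 0
  rw [density_eq]
  exact mul_ne_zero (abs_ne_zero.2 (det_vandermonde_ne_zero_iff.2 hx))
    (prod_ne_zero_iff.2 fun j _ => hxw j trivial)

end Integrability

/-! ### Assembly of the determinant identity. -/

section MainIdentity

open MeasureTheory Matrix Equiv Finset

variable {𝕜 : Type*} [RCLike 𝕜] {I : Set ℝ}

/-- The skew moment matrix `∫ φ_j ε φ_k`. -/
noncomputable def skewMatrix {N : ℕ} (I : Set ℝ) (φ : Fin N → ℝ → 𝕜) : Matrix (Fin N) (Fin N) 𝕜 :=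
  Matrix.of fun j k => ∫ x in I, φ j x * eps I (φ k) x

theorem skewMatrix_transpose {N : ℕ} {φ : Fin N → ℝ → 𝕜} (hφ : ∀ j, IntegrableOn (φ j) I) :
    (skewMatrix I φ)ᵀ = -skewMatrix I φ := by
  ext j k
  exact integral_mul_eps_comm (hφ k) (hφ j)

theorem orderConst_mul_integral {n : ℕ} {p : Fin (n + n) → Polynomial 𝕜}
    (hp : ∀ j, (p j).degree = ((j : ℕ) : WithBot ℕ)) {u : ℝ → 𝕜}
    (hu : ∀ j, IntegrableOn (fun x : ℝ => (p j).eval (x : 𝕜) * u x) I) :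
    orderConst 𝕜 n * (∏ j, (p j).leadingCoeff) *
      ∫ x in cube I (n + n), ((|(vandermonde x).det| : ℝ) : 𝕜) * ∏ j, u (x j) =
    (n + n).factorial * pfSum ((skewMatrix I fun j x => (p j).eval (x : 𝕜) * u x).submatrix
      finSumFinEquiv finSumFinEquiv) := by
  have h := integral_det_mul_pfSum (α := Fin n) (μ := volume.restrict I) measurable_epsKernel
    norm_epsKernel_le fun j => hu (finSumFinEquiv j)
  rw [← integral_comp_equiv finSumFinEquiv] at h
  rw [Fintype.card_sum, Fintype.card_fin] at h
  rw [restrict_cube, ← integral_const_mul]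
  refine Eq.trans (integral_congr_ae (ae_of_all _ fun x => ?_)) h
  simp only
  have hdet : (Matrix.of fun i j : Fin n ⊕ Fin n =>
      (p (finSumFinEquiv j)).eval (x (finSumFinEquiv i) : 𝕜) * u (x (finSumFinEquiv i))).det =
      (∏ j, u (x j)) * (((vandermonde x).det : 𝕜) * ∏ j, (p j).leadingCoeff) := by
    rw [← det_eval_eq hp, ← det_mul_column, ← det_submatrix_equiv_self finSumFinEquiv]
    congr 1
    ext i j
    simp [mul_comm]
  rw [hdet]
  linear_combination -(∏ j, u (x j)) * (∏ j, (p j).leadingCoeff) *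
    det_vandermonde_mul_pfSum (𝕜 := 𝕜) x

/-- What matters is that `κ` is chosen before `u`, so that it cancels between numerator and
denominator. -/
theorem exists_integral_sq_eq_mul_det {n : ℕ} {p : Fin (n + n) → Polynomial 𝕜}
    (hp : ∀ j, (p j).degree = ((j : ℕ) : WithBot ℕ)) :
    ∃ κ : 𝕜, ∀ u : ℝ → 𝕜, (∀ j, IntegrableOn (fun x : ℝ => (p j).eval (x : 𝕜) * u x) I) →
      (∫ x in cube I (n + n), ((|(vandermonde x).det| : ℝ) : 𝕜) * ∏ j, u (x j)) ^ 2 =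
        κ * (skewMatrix I fun j x => (p j).eval (x : 𝕜) * u x).det := by
  have hL : orderConst 𝕜 n * (∏ j, (p j).leadingCoeff) ≠ 0 := by
    refine mul_ne_zero (orderConst_ne_zero n) (prod_ne_zero_iff.2 fun j _ => ?_)
    rw [Polynomial.leadingCoeff_ne_zero, ← Polynomial.degree_ne_bot, hp]
    exact WithBot.coe_ne_bot
  set L := orderConst 𝕜 n * (∏ j, (p j).leadingCoeff)
  refine ⟨((n + n).factorial / L) ^ 2 * (pfSum (J (Fin n) 𝕜) ^ 2 * (J (Fin n) 𝕜).det),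
    fun u hu => ?_⟩
  have h := orderConst_mul_integral hp hu
  have hskew : ((skewMatrix I fun j x => (p j).eval (x : 𝕜) * u x).submatrix
      (finSumFinEquiv (m := n) (n := n)) finSumFinEquiv)ᵀ =
      -(skewMatrix I fun j x => (p j).eval (x : 𝕜) * u x).submatrix
        finSumFinEquiv finSumFinEquiv := by
    rw [transpose_submatrix, skewMatrix_transpose hu]
    rfl
  have hsq := pfSum_sq hskew
  rw [det_submatrix_equiv_self] at hsq
  rw [mul_assoc, ← hsq, ← mul_pow]
  congr 1
  rw [div_mul_eq_mul_div, eq_div_iff hL, mul_comm, h]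

theorem scalarKernel_eq {N : ℕ} {w : ℝ → ℝ} {p : Fin N → Polynomial 𝕜}
    (hψ : ∀ j, IntegrableOn (psi w p j) I) (f : SchwartzMap ℝ 𝕜) (x y : ℝ) :
    scalarKernel I (kernel22 I w p) f x y = ∑ j, eps I (psi w p j) x *
      ∑ k, (momentMatrix I w p)⁻¹ j k * rowFun I f (psi w p k) y := by
  have hK {g : Fin N → ℝ → 𝕜} (hg : ∀ k, IntegrableOn (g k) I) :
      ∫ z in I, (∑ j, ∑ k, (momentMatrix I w p)⁻¹ j k * eps I (psi w p j) x * g k z) *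
        epsKernel z y = ∑ j, ∑ k, (momentMatrix I w p)⁻¹ j k * eps I (psi w p j) x *
          ∫ z in I, g k z * epsKernel z y := by
    simp_rw [sum_mul, mul_assoc ((momentMatrix I w p)⁻¹ _ _ * _)]
    have hi (j k : Fin N) := (integrable_mul_epsKernel (hg k) y).const_mul
      ((momentMatrix I w p)⁻¹ j k * eps I (psi w p j) x)
    rw [integral_finsetSum _ fun j _ => integrable_finsetSum _ fun k _ => hi j k]
    refine sum_congr rfl fun j _ => ?_
    rw [integral_finsetSum _ fun k _ => hi j k]
    exact sum_congr rfl fun k _ => integral_const_mul _ _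
  have h1 := hK hψ
  have h2 := hK (g := fun k z => psi w p k z * f z) fun k =>
    (integrable_schwartz_mul f (hψ k)).congr (ae_of_all _ fun x => mul_comm _ _)
  simp only [scalarKernel, kernelMul, kernelComp, kernel22]
  rw [h1]
  simp_rw [← mul_assoc, ← sum_mul] at h2
  rw [h2]
  simp_rw [sum_mul, mul_sum, ← sum_sub_distrib, rowFun]
  exact sum_congr rfl fun j _ => sum_congr rfl fun k _ => by ring

/-- By `scalarKernel_eq` the kernel has finite rank, with left functions `εψ_j`; the matrix of its
pairings is `M⁻¹ C`, and `det (1 + M⁻¹ C) = det (M + C) / det M`. -/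
theorem isFredholmDet_scalarKernel {a b : EReal} {N : ℕ} {w : ℝ → ℝ} {p : Fin N → Polynomial 𝕜}
    (hψ : ∀ j, IntegrableOn (psi w p j) (interval a b)) {f : SchwartzMap ℝ 𝕜}
    (hf : endValue f a = endValue f b) (hM : IsUnit (momentMatrix (interval a b) w p)) :
    IsFredholmDet (interval a b)
      (scalarKernel (interval a b) (kernel22 (interval a b) w p) f)
      ((momentMatrix (interval a b) w p).det⁻¹ *
        (skewMatrix (interval a b) fun j x => psi w p j x * (1 + f x)).det) := by
  set I := interval a b
  set M := momentMatrix I w p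
  let C : Matrix (Fin N) (Fin N) 𝕜 :=
    Matrix.of fun j k => ∫ x in I, rowFun I f (psi w p j) x * eps I (psi w p k) x
  have hadd : (skewMatrix I fun j x => psi w p j x * (1 + f x)) = M + C := by
    ext j k
    exact integral_perturbed hf (hψ j) (hψ k)
  have hC (i j k : Fin N) : IntegrableOn
      (fun x => M⁻¹ i k * (rowFun I f (psi w p k) x * eps I (psi w p j) x)) I :=
    (integrable_mul_eps (integrable_rowFun f (hψ k)) (hψ j)).const_mul _
  have key := isFredholmDet_finiteRank (scalarKernel_eq hψ f) fun i j => by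
    simp_rw [sum_mul, mul_assoc]
    exact integrable_finsetSum _ fun k _ => hC i j k
  have hG : (Matrix.of fun i j => ∫ x in I, (∑ k, M⁻¹ i k * rowFun I f (psi w p k) x) *
      eps I (psi w p j) x) = M⁻¹ * C := by
    ext i j
    simp_rw [of_apply, sum_mul, mul_assoc]
    rw [integral_finsetSum _ fun k _ => hC i j k, mul_apply]
    exact sum_congr rfl fun k _ => integral_const_mul _ _
  rw [hG] at key
  have hdet : M.det⁻¹ * (skewMatrix I fun j x => psi w p j x * (1 + f x)).det =
      (1 + M⁻¹ * C).det := by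
    have hM' := (Matrix.isUnit_iff_isUnit_det _).1 hM
    rw [hadd, ← Ring.inverse_eq_inv', ← det_nonsing_inv, ← det_mul, mul_add,
      nonsing_inv_mul _ hM']
  rw [hdet]
  exact key

theorem isFredholmDet_genFun_sq {a b : EReal} {w : ℝ → ℝ} (hw : IsWeight (interval a b) w)
    {N : ℕ} (hN : Even N) {p : Fin N → Polynomial 𝕜}
    (hp : ∀ j : Fin N, (p j).degree = ((j : ℕ) : WithBot ℕ)) {f : SchwartzMap ℝ 𝕜}
    (hf : endValue f a = endValue f b) :
    IsUnit (momentMatrix (interval a b) w p) ∧ IsFredholmDet (interval a b)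
      (scalarKernel (interval a b) (kernel22 (interval a b) w p) f)
      (genFun (interval a b) w N f ^ 2) := by
  obtain ⟨n, rfl⟩ := hN
  have hpos := hw.partitionFunction_pos (measurableSet_interval a b) (n + n)
  have hψ (j : Fin (n + n)) : IntegrableOn (psi w p j) (interval a b) :=
    integrable_eval_mul hw.integrable_pow_mul (p j)
  obtain ⟨κ, hκ⟩ := exists_integral_sq_eq_mul_det (I := interval a b) hp
  have h1 := hκ (fun x => (w x : 𝕜)) hψ
  have h2 := hκ (fun x => (w x : 𝕜) * (1 + f x)) fun j =>
    integrable_eval_mul (hw.integrable_pow_mul_one_add f) (p j)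
  have hZ : ∫ x in cube (interval a b) (n + n),
      ((|(Matrix.vandermonde x).det| : ℝ) : 𝕜) * ∏ j, (w (x j) : 𝕜) =
      (partitionFunction (interval a b) w (n + n) : 𝕜) := by
    rw [partitionFunction, ← integral_ofReal]
    simp_rw [density_eq, RCLike.ofReal_mul, RCLike.ofReal_prod]
  rw [hZ, show (skewMatrix (interval a b) fun j x => (p j).eval (x : 𝕜) * (w x : 𝕜)) =
    momentMatrix (interval a b) w p from rfl] at h1
  simp_rw [← genIntegrand_eq, ← mul_assoc] at h2
  have hZ0 : (partitionFunction (interval a b) w (n + n) : 𝕜) ≠ 0 :=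
    RCLike.ofReal_ne_zero.2 hpos.ne'
  -- Positivity of the normalisation makes `κ * det M` nonzero, which gives invertibility of `M` and
  -- allows `κ` to be cancelled.
  have hprod := h1 ▸ pow_ne_zero 2 hZ0
  have hM : IsUnit (momentMatrix (interval a b) w p) :=
    (Matrix.isUnit_iff_isUnit_det _).2 (right_ne_zero_of_mul hprod).isUnit
  refine ⟨hM, ?_⟩
  have hdet : genFun (interval a b) w (n + n) f ^ 2 =
      (momentMatrix (interval a b) w p).det⁻¹ *
        (skewMatrix (interval a b) fun j x => psi w p j x * (1 + f x)).det := by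
    rw [genFun, mul_pow, h2, inv_pow, h1, mul_inv, mul_assoc, mul_comm _ (κ * _), mul_assoc,
      inv_mul_cancel_left₀ (left_ne_zero_of_mul hprod), mul_comm]
    rfl
  rw [hdet]
  exact isFredholmDet_scalarKernel hψ hf hM

end MainIdentity

end OrthogonalEnsemble

theorem mainTheorem6 {𝕜 : Type*} [RCLike 𝕜] (a b : EReal) (w : ℝ → ℝ)
    (hw : OrthogonalEnsemble.IsWeight (OrthogonalEnsemble.interval a b) w)
    (N : ℕ) (hN : Even N)
    (p : Fin N → Polynomial 𝕜) (hp : ∀ j : Fin N, (p j).degree = ((j : ℕ) : WithBot ℕ))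
    (f : SchwartzMap ℝ 𝕜)
    (hf : OrthogonalEnsemble.endValue f a = OrthogonalEnsemble.endValue f b) :
    0 < OrthogonalEnsemble.partitionFunction (OrthogonalEnsemble.interval a b) w N ∧
    MeasureTheory.IntegrableOn (OrthogonalEnsemble.genIntegrand w N f)
      (OrthogonalEnsemble.cube (OrthogonalEnsemble.interval a b) N) ∧
    IsUnit (OrthogonalEnsemble.momentMatrix (OrthogonalEnsemble.interval a b) w p) ∧
    OrthogonalEnsemble.IsFredholmDet (OrthogonalEnsemble.interval a b)
      (OrthogonalEnsemble.scalarKernel (OrthogonalEnsemble.interval a b)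
        (OrthogonalEnsemble.kernel22 (OrthogonalEnsemble.interval a b) w p) f)
      (OrthogonalEnsemble.genFun (OrthogonalEnsemble.interval a b) w N f ^ 2) := by
  exact ⟨hw.partitionFunction_pos (OrthogonalEnsemble.measurableSet_interval a b) N,
    hw.integrable_genIntegrand N f, OrthogonalEnsemble.isFredholmDet_genFun_sq hw hN hp hf⟩
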